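/- Let $C_1,C_2,C_3$ be compact (connected) Riemann surfaces of genus at least two and let $G$ be a subgroup of $\operatorname{Aut}(C_1\times C_2\times C_3)$, the group of biholomorphic self-maps. Put $$G^0:=G\cap\big(\operatorname{Aut}(C_1)\times\operatorname{Aut}(C_2)\times\operatorname{Aut}(C_3)\big),$$ let $G_i\le G$ be the subgroup of those $g\in G$ that are a product of an automorphism of $C_i$ and an automorphism of the product of the other two curves, and let $\psi_i\colon G_i\to\operatorname{Aut}(C_i)$ be the restriction homomorphism. For a biholomorphic map $\xi$ from $C_1\times C_2\times C_3$ to another product of three curves, "after conjugating with $\xi$" means that $G$, its elements, $G^0$, $G_i$ and $\psi_i$ are replaced by the corresponding objects for $\xi G\xi^{-1}$. i) Suppose $[G:G^0]=2$ and let $\delta\in G$ be of the form $\delta(x,y,z)=(\delta_1x,\delta_3z,\delta_2y)$ with biholomorphic maps $\delta_1\colon C_1\to C_1$, $\delta_2\colon C_2\to C_3$, $\delta_3\colon C_3\to C_2$. Then, after conjugating with $\xi\colon C_1\times C_2\times C_3\to C_1\times C_2\times C_2$, $\xi(x,y,z)=(x,y,\delta_3z)$ (an element of $\operatorname{Aut}(C_1)\times\operatorname{Aut}(C_2)\times\operatorname{Aut}(C_3)$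 if $C_2=C_3$), one has $\psi_3(g)=\psi_2(\delta g\delta^{-1})$ for all $g\in G^0$, every element of $G$ has the form $g$ or $\delta g$ with $g\in G^0$, and the action is given by - $\delta(x,y,z)=\big(\psi_1(\delta)x,\;z,\;\psi_2(\delta^2)y\big)$, - $g(x,y,z)=\big(\psi_1(g)x,\;\psi_2(g)y,\;\psi_2(\delta g\delta^{-1})z\big)$ for all $g\in G^0$. ii) Suppose $[G:G^0]=3$ and let $\tau\in G$ be of the form $\tau(x,y,z)=(\tau_2y,\tau_3z,\tau_1x)$ with biholomorphic maps $\tau_1\colon C_1\to C_3$, $\tau_2\colon C_2\to C_1$, $\tau_3\colon C_3\to C_2$. Then, after conjugating with $\epsilon\colon C_1\times C_2\times C_3\to C_1^3$, $\epsilon(x,y,z)=(x,\tau_2y,\tau_2\tau_3z)$ (an element of $\operatorname{Aut}(C_1)\times\operatorname{Aut}(C_2)\times\operatorname{Aut}(C_3)$ if $C_1=C_2=C_3$), one has $\psi_2(g)=\psi_1(\tau g\tau^{-1})$ and $\psi_3(g)=\psi_1(\tau^2g\tau^{-2})$ for all $g\in G^0$, every element of $G$ has the form $\tau^ig$ with $0\le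 i\le 2$ and $g\in G^0$, and the action is given by - $\tau(x,y,z)=\big(y,\;z,\;\psi_1(\tau^3)x\big)$, - $g(x,y,z)=\big(\psi_1(g)x,\;\psi_1(\tau g\tau^{-1})y,\;\psi_1(\tau^2g\tau^{-2})z\big)$ for all $g\in G^0$. iii) Suppose $[G:G^0]=6$ and let $\tau\in G$ and $\epsilon$ be of the same form as in ii). Then, after conjugating with $\epsilon$, one has $\psi_2(h)=\psi_1(\tau h\tau^{-1})$ for all $h\in G_2$ and $\psi_3(k)=\psi_1(\tau^2k\tau^{-2})$ for all $k\in G_3$, every element of $G$ has the form $\tau^ig$ with $0\le i\le 2$ and $g\in G_1$, and the action is given by - $\tau(x,y,z)=\big(y,\;z,\;\psi_1(\tau^3)x\big)$, - $g(x,y,z)=\big(\psi_1(g)x,\;\psi_1(\tau g\tau^{-1})y,\;\psi_1(\tau^2g\tau^{-2})z\big)$ for all $g\in G^0$, - $f(x,y,z)=\big(\psi_1(f)x,\;\psi_1(\tau f\tau^{-2})z,\;\psi_1(\tau^2f\tau^{-1})y\big)$ for all $f\in G_1\setminus G^0$. In each formula the elements to which $\psi_i$ is applied lie in $G_i$. 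-/

import Mathlib

open scoped Manifold ContDiff

noncomputable section

namespace MixedAction

/-! ### Genus and groups of biholomorphic maps -/

/-- The space of holomorphic `1`-forms on a Riemann surface `C`: the (complex) analytic sections
of the holomorphic cotangent bundle `x ↦ Hom(T_x C, ℂ)`. -/
abbrev HolOneForm (C : Type*) [TopologicalSpace C] [ChartedSpace ℂ C] [IsManifold 𝓘(ℂ) ω C] :
    Type _ :=
  ContMDiffSection 𝓘(ℂ) (ℂ →L[ℂ] ℂ) ω (fun x : C => TangentSpace 𝓘(ℂ) x →L[ℂ] ℂ)

/-- The genus of a compact Riemann surface: the dimension of its space of holomorphic `1`-forms. -/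
def genus (C : Type*) [TopologicalSpace C] [ChartedSpace ℂ C] [IsManifold 𝓘(ℂ) ω C] : ℕ :=
  Module.finrank ℂ (HolOneForm C)

section Group

variable {E H M : Type*} [NormedAddCommGroup E] [NormedSpace ℂ E] [TopologicalSpace H]
  {I : ModelWithCorners ℂ E H} [TopologicalSpace M] [ChartedSpace H M]
  {E' H' M' : Type*} [NormedAddCommGroup E'] [NormedSpace ℂ E'] [TopologicalSpace H']
  {I' : ModelWithCorners ℂ E' H'} [TopologicalSpace M'] [ChartedSpace H' M']

/-- Biholomorphic self-maps form a group under composition: `(f * g) x = f (g x)`. -/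
instance instGroupBihol : Group (Diffeomorph I I M M ω) where
  mul f g := g.trans f
  one := Diffeomorph.refl I M ω
  inv f := f.symm
  mul_assoc _ _ _ := rfl
  one_mul _ := rfl
  mul_one _ := rfl
  inv_mul_cancel f := f.self_trans_symm

theorem mul_apply (f g : Diffeomorph I I M M ω) (x : M) : (f * g) x = f (g x) := rfl

theorem one_apply (x : M) : (1 : Diffeomorph I I M M ω) x = x := rfl

theorem inv_apply_self (f : Diffeomorph I I M M ω) (x : M) : f⁻¹ (f x) = x :=
  f.symm_apply_apply x

theorem apply_inv_self (f : Diffeomorph I I M M ω) (x : M) : f (f⁻¹ x) = x :=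
  f.apply_symm_apply x

/-- Conjugation `g ↦ ξ ∘ g ∘ ξ⁻¹` by a biholomorphic map `ξ : M → M'`. -/
def conj (ξ : Diffeomorph I I' M M' ω) :
    Diffeomorph I I M M ω →* Diffeomorph I' I' M' M' ω where
  toFun g := (ξ.symm.trans g).trans ξ
  map_one' := ξ.symm_trans_self
  map_mul' f g := Diffeomorph.ext fun x =>
    congrArg (fun t => ξ (f t)) (ξ.symm_apply_apply (g (ξ.symm x))).symm

theorem conj_apply (ξ : Diffeomorph I I' M M' ω) (g : Diffeomorph I I M M ω) (m : M') :
    conj ξ g m = ξ (g (ξ.symm m)) := rfl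

end Group

/-- Biholomorphic maps between Riemann surfaces. -/
abbrev CurveIso (X Y : Type*) [TopologicalSpace X] [ChartedSpace ℂ X]
    [TopologicalSpace Y] [ChartedSpace ℂ Y] : Type _ :=
  Diffeomorph 𝓘(ℂ) 𝓘(ℂ) X Y ω

/-- `Aut(X)` for a Riemann surface `X`. -/
abbrev AutCurve (X : Type*) [TopologicalSpace X] [ChartedSpace ℂ X] : Type _ := CurveIso X X

/-- `Aut(X × Y)`: all biholomorphic self-maps of a product of two Riemann surfaces. -/
abbrev AutTwo (X Y : Type*) [TopologicalSpace X] [ChartedSpace ℂ X]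
    [TopologicalSpace Y] [ChartedSpace ℂ Y] : Type _ :=
  Diffeomorph (𝓘(ℂ).prod 𝓘(ℂ)) (𝓘(ℂ).prod 𝓘(ℂ)) (X × Y) (X × Y) ω

/-- `Aut(X × Y × Z)`: all biholomorphic self-maps of a product of three Riemann surfaces. -/
abbrev AutThree (X Y Z : Type*) [TopologicalSpace X] [ChartedSpace ℂ X]
    [TopologicalSpace Y] [ChartedSpace ℂ Y] [TopologicalSpace Z] [ChartedSpace ℂ Z] : Type _ :=
  Diffeomorph (𝓘(ℂ).prod (𝓘(ℂ).prod 𝓘(ℂ))) (𝓘(ℂ).prod (𝓘(ℂ).prod 𝓘(ℂ)))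
    (X × Y × Z) (X × Y × Z) ω

section Product

variable {X Y Z X' Y' Z' : Type*}
  [TopologicalSpace X] [ChartedSpace ℂ X] [TopologicalSpace Y] [ChartedSpace ℂ Y]
  [TopologicalSpace Z] [ChartedSpace ℂ Z] [TopologicalSpace X'] [ChartedSpace ℂ X']
  [TopologicalSpace Y'] [ChartedSpace ℂ Y'] [TopologicalSpace Z'] [ChartedSpace ℂ Z']

/-- The product map `(x, y, z) ↦ (a x, b y, c z)` of three biholomorphic maps. -/
def prodThree (a : CurveIso X X') (b : CurveIso Y Y') (c : CurveIso Z Z') :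
    Diffeomorph (𝓘(ℂ).prod (𝓘(ℂ).prod 𝓘(ℂ))) (𝓘(ℂ).prod (𝓘(ℂ).prod 𝓘(ℂ)))
      (X × Y × Z) (X' × Y' × Z') ω :=
  a.prodCongr (b.prodCongr c)

theorem prodThree_apply (a : CurveIso X X') (b : CurveIso Y Y') (c : CurveIso Z Z')
    (x : X) (y : Y) (z : Z) : prodThree a b c (x, y, z) = (a x, b y, c z) := rfl

/-- The normalising map `ξ(x, y, z) = (x, y, δ₃ z)` of the index two case. -/
def xiMap (δ₃ : CurveIso Z Y) :
    Diffeomorph (𝓘(ℂ).prod (𝓘(ℂ).prod 𝓘(ℂ))) (𝓘(ℂ).prod (𝓘(ℂ).prod 𝓘(ℂ)))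
      (X × Y × Z) (X × Y × Y) ω :=
  prodThree (.refl 𝓘(ℂ) X ω) (.refl 𝓘(ℂ) Y ω) δ₃

theorem xiMap_apply (δ₃ : CurveIso Z Y) (x : X) (y : Y) (z : Z) :
    xiMap δ₃ (x, y, z) = (x, y, δ₃ z) := rfl

/-- The normalising map `ε(x, y, z) = (x, τ₂ y, τ₂ τ₃ z)` of the index three and six cases. -/
def epsMap (τ₂ : CurveIso Y X) (τ₃ : CurveIso Z Y) :
    Diffeomorph (𝓘(ℂ).prod (𝓘(ℂ).prod 𝓘(ℂ))) (𝓘(ℂ).prod (𝓘(ℂ).prod 𝓘(ℂ)))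
      (X × Y × Z) (X × X × X) ω :=
  prodThree (.refl 𝓘(ℂ) X ω) τ₂ (τ₃.trans τ₂)

theorem epsMap_apply (τ₂ : CurveIso Y X) (τ₃ : CurveIso Z Y) (x : X) (y : Y) (z : Z) :
    epsMap τ₂ τ₃ (x, y, z) = (x, τ₂ y, τ₂ (τ₃ z)) := rfl

end Product

/-! ### Restriction to a factor -/

section Split

variable {E H M : Type*} [NormedAddCommGroup E] [NormedSpace ℂ E] [TopologicalSpace H]
  {I : ModelWithCorners ℂ E H} [TopologicalSpace M] [ChartedSpace H M]
  {E₁ H₁ A : Type*} [NormedAddCommGroup E₁] [NormedSpace ℂ E₁] [TopologicalSpace H₁]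
  (I₁ : ModelWithCorners ℂ E₁ H₁) [TopologicalSpace A] [ChartedSpace H₁ A]
  {E₂ H₂ B : Type*} [NormedAddCommGroup E₂] [NormedSpace ℂ E₂] [TopologicalSpace H₂]
  (I₂ : ModelWithCorners ℂ E₂ H₂) [TopologicalSpace B] [ChartedSpace H₂ B]

/-- For a splitting `e : M ≃ A × B`, the subgroup `Aut(A) × Aut(B)` of `Aut(M)`: the
biholomorphic maps `g` of `M` that become `(a, b) ↦ (φ a, F b)` under `e`, for some
`φ ∈ Aut(A)` and `F ∈ Aut(B)`. -/
def splitSubgroup (e : M ≃ A × B) : Subgroup (Diffeomorph I I M M ω) where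
  carrier := {g | ∃ (φ : Diffeomorph I₁ I₁ A A ω) (F : Diffeomorph I₂ I₂ B B ω),
    ∀ m, e (g m) = (φ (e m).1, F (e m).2)}
  mul_mem' := by
    rintro g g' ⟨φ, F, h⟩ ⟨φ', F', h'⟩
    refine ⟨φ * φ', F * F', fun m => ?_⟩
    rw [mul_apply, h, h']
    rfl
  one_mem' := ⟨1, 1, fun _ => rfl⟩
  inv_mem' := by
    rintro g ⟨φ, F, h⟩
    refine ⟨φ⁻¹, F⁻¹, fun m => ?_⟩
    have h1 := h (g⁻¹ m)
    rw [apply_inv_self] at h1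
    rw [h1]
    simp only [inv_apply_self]

/-- The restriction homomorphism `Aut(A) × Aut(B) → Aut(A)` for a splitting `M ≃ A × B`:
`g` is sent to the unique `φ ∈ Aut(A)` over which it lies. -/
def splitRestrict [Nonempty B] (e : M ≃ A × B) :
    splitSubgroup (I := I) I₁ I₂ e →* Diffeomorph I₁ I₁ A A ω :=
  have key : ∀ (g : splitSubgroup (I := I) I₁ I₂ e) (a : A) (b : B),
      g.2.choose a = (e (g.1 (e.symm (a, b)))).1 := fun g a b => by
    obtain ⟨F, hF⟩ := g.2.choose_spec
    rw [hF]
    simp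
  { toFun := fun g => g.2.choose
    map_one' := Diffeomorph.ext fun a => by
      rw [key 1 a (Classical.arbitrary B), one_apply]
      simp [one_apply]
    map_mul' := fun g g' => Diffeomorph.ext fun a => by
      obtain ⟨F', hF'⟩ := g'.2.choose_spec
      obtain ⟨F, hF⟩ := g.2.choose_spec
      rw [key (g * g') a (Classical.arbitrary B), mul_apply]
      change (e (g.1 (g'.1 _))).1 = _
      rw [hF, hF']
      simp }

/-- The restriction is characterised by compatibility with the projection `M → A`. -/
theorem splitRestrict_apply [Nonempty B] (e : M ≃ A × B)
    (g : splitSubgroup (I := I) I₁ I₂ e) (m : M) :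
    splitRestrict I₁ I₂ e g (e m).1 = (e (g.1 m)).1 := by
  obtain ⟨F, hF⟩ := g.2.choose_spec
  rw [hF]
  rfl

end Split

section Factors

variable {C₁ C₂ C₃ : Type*}
  [TopologicalSpace C₁] [ChartedSpace ℂ C₁] [TopologicalSpace C₂] [ChartedSpace ℂ C₂]
  [TopologicalSpace C₃] [ChartedSpace ℂ C₃]

/-- The splitting of `C₁ × C₂ × C₃` into `C₁` and `C₂ × C₃`. -/
def splitting₁ : C₁ × C₂ × C₃ ≃ C₁ × (C₂ × C₃) := Equiv.refl _

/-- The splitting of `C₁ × C₂ × C₃` into `C₂` and `C₁ × C₃`. -/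
def splitting₂ : C₁ × C₂ × C₃ ≃ C₂ × (C₁ × C₃) where
  toFun p := (p.2.1, (p.1, p.2.2))
  invFun q := (q.2.1, q.1, q.2.2)
  left_inv _ := rfl
  right_inv _ := rfl

/-- The splitting of `C₁ × C₂ × C₃` into `C₃` and `C₁ × C₂`. -/
def splitting₃ : C₁ × C₂ × C₃ ≃ C₃ × (C₁ × C₂) where
  toFun p := (p.2.2, (p.1, p.2.1))
  invFun q := (q.2.1, q.2.2, q.1)
  left_inv _ := rfl
  right_inv _ := rfl

variable (G : Subgroup (AutThree C₁ C₂ C₃))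

/-- The diagonal subgroup `G⁰ = G ∩ (Aut(C₁) × Aut(C₂) × Aut(C₃))`. -/
def diagonal : Subgroup (AutThree C₁ C₂ C₃) :=
  G ⊓
  { carrier := {g | ∃ (a : AutCurve C₁) (b : AutCurve C₂) (c : AutCurve C₃),
      g = prodThree a b c}
    mul_mem' := by
      rintro _ _ ⟨a, b, c, rfl⟩ ⟨a', b', c', rfl⟩
      exact ⟨a * a', b * b', c * c', rfl⟩
    one_mem' := ⟨1, 1, 1, rfl⟩
    inv_mem' := by
      rintro _ ⟨a, b, c, rfl⟩
      exact ⟨a⁻¹, b⁻¹, c⁻¹, rfl⟩ }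

/-- `G₁ = G ∩ (Aut(C₂ × C₃) × Aut(C₁))`. -/
def factor₁ : Subgroup (AutThree C₁ C₂ C₃) :=
  G ⊓ splitSubgroup 𝓘(ℂ) (𝓘(ℂ).prod 𝓘(ℂ)) splitting₁

/-- `G₂ = G ∩ (Aut(C₁ × C₃) × Aut(C₂))`. -/
def factor₂ : Subgroup (AutThree C₁ C₂ C₃) :=
  G ⊓ splitSubgroup 𝓘(ℂ) (𝓘(ℂ).prod 𝓘(ℂ)) splitting₂

/-- `G₃ = G ∩ (Aut(C₁ × C₂) × Aut(C₃))`. -/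
def factor₃ : Subgroup (AutThree C₁ C₂ C₃) :=
  G ⊓ splitSubgroup 𝓘(ℂ) (𝓘(ℂ).prod 𝓘(ℂ)) splitting₃

/-- The restriction homomorphism `ψ₁ : G₁ → Aut(C₁)`. -/
def ψ₁ [Nonempty C₂] [Nonempty C₃] : factor₁ G →* AutCurve C₁ :=
  (splitRestrict 𝓘(ℂ) (𝓘(ℂ).prod 𝓘(ℂ)) splitting₁).comp (Subgroup.inclusion inf_le_right)

/-- The restriction homomorphism `ψ₂ : G₂ → Aut(C₂)`. -/
def ψ₂ [Nonempty C₁] [Nonempty C₃] : factor₂ G →* AutCurve C₂ :=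
  (splitRestrict 𝓘(ℂ) (𝓘(ℂ).prod 𝓘(ℂ)) splitting₂).comp (Subgroup.inclusion inf_le_right)

/-- The restriction homomorphism `ψ₃ : G₃ → Aut(C₃)`. -/
def ψ₃ [Nonempty C₁] [Nonempty C₂] : factor₃ G →* AutCurve C₃ :=
  (splitRestrict 𝓘(ℂ) (𝓘(ℂ).prod 𝓘(ℂ)) splitting₃).comp (Subgroup.inclusion inf_le_right)

theorem ψ₁_apply [Nonempty C₂] [Nonempty C₃] (g : factor₁ G) (p : C₁ × C₂ × C₃) :
    ψ₁ G g p.1 = (g.1 p).1 :=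
  splitRestrict_apply 𝓘(ℂ) (𝓘(ℂ).prod 𝓘(ℂ)) splitting₁ ⟨g.1, g.2.2⟩ p

theorem ψ₂_apply [Nonempty C₁] [Nonempty C₃] (g : factor₂ G) (p : C₁ × C₂ × C₃) :
    ψ₂ G g p.2.1 = (g.1 p).2.1 :=
  splitRestrict_apply 𝓘(ℂ) (𝓘(ℂ).prod 𝓘(ℂ)) splitting₂ ⟨g.1, g.2.2⟩ p

theorem ψ₃_apply [Nonempty C₁] [Nonempty C₂] (g : factor₃ G) (p : C₁ × C₂ × C₃) :
    ψ₃ G g p.2.2 = (g.1 p).2.2 :=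
  splitRestrict_apply 𝓘(ℂ) (𝓘(ℂ).prod 𝓘(ℂ)) splitting₃ ⟨g.1, g.2.2⟩ p

end Factors

/-! ### Normal forms

In the three definitions below a clause `∃ (h : g ∈ Gᵢ), …` asserts that `g` lies in the domain
`Gᵢ` of `ψᵢ`, so that `ψᵢ(g)` makes sense, and then states the formula. -/

section NormalForm

variable {D C : Type*} [TopologicalSpace D] [ChartedSpace ℂ D]
  [TopologicalSpace C] [ChartedSpace ℂ C] [Nonempty D] [Nonempty C]

/-- The normal form in the index two case, for a group acting on `D × C × C`. -/
structure IsNormalFormTwo (G : Subgroup (AutThree D C C)) (δ : AutThree D C C) : Prop where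
  /-- `ψ₃(g) = ψ₂(δ g δ⁻¹)` for all `g ∈ G⁰`. -/
  psi_three : ∀ g ∈ diagonal G, ∃ (h₃ : g ∈ factor₃ G) (h₂ : δ * g * δ⁻¹ ∈ factor₂ G),
    ψ₃ G ⟨g, h₃⟩ = ψ₂ G ⟨δ * g * δ⁻¹, h₂⟩
  /-- `δ(x, y, z) = (ψ₁(δ) x, z, ψ₂(δ²) y)`. -/
  delta_form : ∃ (h₁ : δ ∈ factor₁ G) (h₂ : δ ^ 2 ∈ factor₂ G), ∀ x y z,
    δ (x, y, z) = (ψ₁ G ⟨δ, h₁⟩ x, z, ψ₂ G ⟨δ ^ 2, h₂⟩ y)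
  /-- `g(x, y, z) = (ψ₁(g) x, ψ₂(g) y, ψ₂(δ g δ⁻¹) z)` for all `g ∈ G⁰`. -/
  diagonal_form : ∀ g ∈ diagonal G,
    ∃ (h₁ : g ∈ factor₁ G) (h₂ : g ∈ factor₂ G) (h₃ : δ * g * δ⁻¹ ∈ factor₂ G), ∀ x y z,
      g (x, y, z) = (ψ₁ G ⟨g, h₁⟩ x, ψ₂ G ⟨g, h₂⟩ y, ψ₂ G ⟨δ * g * δ⁻¹, h₃⟩ z)
  /-- The formulas determine the whole action: `G = G⁰ ∪ δ G⁰`. -/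
  exhaust : ∀ h ∈ G, ∃ g ∈ diagonal G, h = g ∨ h = δ * g

/-- The normal form in the index three case, for a group acting on `C × C × C`. -/
structure IsNormalFormThree (G : Subgroup (AutThree C C C)) (τ : AutThree C C C) : Prop where
  /-- `ψ₂(g) = ψ₁(τ g τ⁻¹)` for all `g ∈ G⁰`. -/
  psi_two : ∀ g ∈ diagonal G, ∃ (h₂ : g ∈ factor₂ G) (h₁ : τ * g * τ⁻¹ ∈ factor₁ G),
    ψ₂ G ⟨g, h₂⟩ = ψ₁ G ⟨τ * g * τ⁻¹, h₁⟩
  /-- `ψ₃(g) = ψ₁(τ² g τ⁻²)` for all `g ∈ G⁰`. -/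
  psi_three : ∀ g ∈ diagonal G,
    ∃ (h₃ : g ∈ factor₃ G) (h₁ : τ ^ 2 * g * (τ ^ 2)⁻¹ ∈ factor₁ G),
      ψ₃ G ⟨g, h₃⟩ = ψ₁ G ⟨τ ^ 2 * g * (τ ^ 2)⁻¹, h₁⟩
  /-- `τ(x, y, z) = (y, z, ψ₁(τ³) x)`. -/
  tau_form : ∃ (h₁ : τ ^ 3 ∈ factor₁ G), ∀ x y z,
    τ (x, y, z) = (y, z, ψ₁ G ⟨τ ^ 3, h₁⟩ x)
  /-- `g(x, y, z) = (ψ₁(g) x, ψ₁(τ g τ⁻¹) y, ψ₁(τ² g τ⁻²) z)` for all `g ∈ G⁰`. -/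
  diagonal_form : ∀ g ∈ diagonal G,
    ∃ (h₁ : g ∈ factor₁ G) (h₂ : τ * g * τ⁻¹ ∈ factor₁ G)
      (h₃ : τ ^ 2 * g * (τ ^ 2)⁻¹ ∈ factor₁ G), ∀ x y z,
      g (x, y, z) = (ψ₁ G ⟨g, h₁⟩ x, ψ₁ G ⟨τ * g * τ⁻¹, h₂⟩ y,
        ψ₁ G ⟨τ ^ 2 * g * (τ ^ 2)⁻¹, h₃⟩ z)
  /-- The formulas determine the whole action: `G = G⁰ ∪ τ G⁰ ∪ τ² G⁰`. -/
  exhaust : ∀ h ∈ G, ∃ g ∈ diagonal G, h = g ∨ h = τ * g ∨ h = τ ^ 2 * g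

/-- The normal form in the index six case, for a group acting on `C × C × C`. -/
structure IsNormalFormSix (G : Subgroup (AutThree C C C)) (τ : AutThree C C C) : Prop where
  /-- `ψ₂(h) = ψ₁(τ h τ⁻¹)` for all `h ∈ G₂`. -/
  psi_two : ∀ (h : AutThree C C C) (h₂ : h ∈ factor₂ G), ∃ (h₁ : τ * h * τ⁻¹ ∈ factor₁ G),
    ψ₂ G ⟨h, h₂⟩ = ψ₁ G ⟨τ * h * τ⁻¹, h₁⟩
  /-- `ψ₃(k) = ψ₁(τ² k τ⁻²)` for all `k ∈ G₃`. -/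
  psi_three : ∀ (k : AutThree C C C) (h₃ : k ∈ factor₃ G),
    ∃ (h₁ : τ ^ 2 * k * (τ ^ 2)⁻¹ ∈ factor₁ G),
      ψ₃ G ⟨k, h₃⟩ = ψ₁ G ⟨τ ^ 2 * k * (τ ^ 2)⁻¹, h₁⟩
  /-- `τ(x, y, z) = (y, z, ψ₁(τ³) x)`. -/
  tau_form : ∃ (h₁ : τ ^ 3 ∈ factor₁ G), ∀ x y z,
    τ (x, y, z) = (y, z, ψ₁ G ⟨τ ^ 3, h₁⟩ x)
  /-- `g(x, y, z) = (ψ₁(g) x, ψ₁(τ g τ⁻¹) y, ψ₁(τ² g τ⁻²) z)` for all `g ∈ G⁰`. -/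
  diagonal_form : ∀ g ∈ diagonal G,
    ∃ (h₁ : g ∈ factor₁ G) (h₂ : τ * g * τ⁻¹ ∈ factor₁ G)
      (h₃ : τ ^ 2 * g * (τ ^ 2)⁻¹ ∈ factor₁ G), ∀ x y z,
      g (x, y, z) = (ψ₁ G ⟨g, h₁⟩ x, ψ₁ G ⟨τ * g * τ⁻¹, h₂⟩ y,
        ψ₁ G ⟨τ ^ 2 * g * (τ ^ 2)⁻¹, h₃⟩ z)
  /-- `f(x, y, z) = (ψ₁(f) x, ψ₁(τ f τ⁻²) z, ψ₁(τ² f τ⁻¹) y)` for all `f ∈ G₁ \ G⁰`. -/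
  swap_form : ∀ (f : AutThree C C C) (h₁ : f ∈ factor₁ G), f ∉ diagonal G →
    ∃ (h₂ : τ * f * (τ ^ 2)⁻¹ ∈ factor₁ G) (h₃ : τ ^ 2 * f * τ⁻¹ ∈ factor₁ G), ∀ x y z,
      f (x, y, z) = (ψ₁ G ⟨f, h₁⟩ x, ψ₁ G ⟨τ * f * (τ ^ 2)⁻¹, h₂⟩ z,
        ψ₁ G ⟨τ ^ 2 * f * τ⁻¹, h₃⟩ y)
  /-- The formulas determine the whole action: `G = G₁ ∪ τ G₁ ∪ τ² G₁`. -/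
  exhaust : ∀ h ∈ G, ∃ g ∈ factor₁ G, h = g ∨ h = τ * g ∨ h = τ ^ 2 * g

end NormalForm

end MixedAction

end

open MixedAction

noncomputable section

/-! The normalising maps are products of curve isomorphisms, so they respect `diagonal` and its
index, and they turn `δ` into `(x, y, z) ↦ (a x, z, d y)` and `τ` into `(x, y, z) ↦ (y, z, t x)`.
Conjugation by `δ`, `τ` or `τ²` then moves a chosen component of an automorphism into the slot read
by `ψ₂` or `ψ₁`, and each formula is a comparison of one coordinate. The twists are recovered from
`δ² = (a², d, d)` and `τ³ = (t, t, t)`. In index two and three, counting cosets of the diagonal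
subgroup shows that nothing else is in the group.

Index six also involves maps that preserve one factor and may mix the other two, so it rests on
rigidity: an automorphism of `C × C × C` permutes the factors when the genus is at least two. The
core is `apply_eq_or_apply_eq`. For `f : X × Y → C`, pulling a 1-form back along `f(x, ·)` gives, at
a fixed tangent vector, a holomorphic function of `x` on a compact connected curve, hence a
constant. If such a value is non-zero, two independent forms have a combination that pulls back to
zero along one slice `f(·, y₀)`, because cotangent spaces are lines; that slice is therefore
constant, and so are the parallel ones. Slicing extends this to three variables
(`exists_coord_dependence`), and `coordIndex` records the permutation, which reduces index six to
arithmetic in `Fin 3`. -/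

namespace MixedAction

/-! ### Holomorphic 1-forms and the identity theorem -/

section OneForm

variable {C : Type*} [TopologicalSpace C] [ChartedSpace ℂ C] [IsManifold 𝓘(ℂ) ω C]

/-- A holomorphic `1`-form, viewed as a function on the tangent bundle. -/
def HolOneForm.eval (η : HolOneForm C) (v : TangentBundle 𝓘(ℂ) C) : ℂ := η v.1 v.2

/-- Evaluation pairs the pulled-back section `η` with the tautological tangent vector. This is what
makes pullbacks of forms holomorphic in a parameter. -/
theorem HolOneForm.contMDiff_eval (η : HolOneForm C) :
    ContMDiff 𝓘(ℂ).tangent 𝓘(ℂ) ω η.eval := by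
  have h₁ : ContMDiff 𝓘(ℂ).tangent (𝓘(ℂ).prod 𝓘(ℂ, ℂ →L[ℂ] ℂ)) ω
      (fun v : TangentBundle 𝓘(ℂ) C => Bundle.TotalSpace.mk' (ℂ →L[ℂ] ℂ)
        (E := fun x : C => TangentSpace 𝓘(ℂ) x →L[ℂ] ℂ) v.1 (η v.1)) :=
    η.contMDiff.comp (Bundle.contMDiff_proj _)
  have h₂ := ContMDiff.clm_bundle_apply (F₁ := ℂ) (F₂ := ℂ)
    (E₁ := fun x : C => TangentSpace 𝓘(ℂ) x) (E₂ := Bundle.Trivial C ℂ) (n := ω)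
    (b := fun v : TangentBundle 𝓘(ℂ) C => v.1) (v := fun v => v.2) (ϕ := fun v => η v.1)
    h₁ contMDiff_id
  intro v
  exact ((Bundle.contMDiffAt_totalSpace).1 (h₂ v)).2

/-- Near every point the vanishing locus of a `1`-form is that of an analytic function. -/
theorem HolOneForm.exists_analyticAt (η : HolOneForm C) (q : C) :
    ∃ k : ℂ → (ℂ →L[ℂ] ℂ), AnalyticAt ℂ k (extChartAt 𝓘(ℂ) q q) ∧
      ∀ z ∈ (extChartAt 𝓘(ℂ) q).target, k z = 0 ↔ η ((extChartAt 𝓘(ℂ) q).symm z) = 0 := by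
  let V : C → Type _ := fun x : C => TangentSpace 𝓘(ℂ) x →L[ℂ] ℂ
  let e := trivializationAt (ℂ →L[ℂ] ℂ) V q
  have h := (Bundle.contMDiffAt_section (F := ℂ →L[ℂ] ℂ) (E := V) (s := η) q).1
    (η.contMDiff q)
  refine ⟨fun z => (e ⟨(extChartAt 𝓘(ℂ) q).symm z, η ((extChartAt 𝓘(ℂ) q).symm z)⟩).2, ?_, ?_⟩
  · have h' := (contMDiffAt_iff.1 h).2
    simp only [extChartAt_model_space_eq_id, modelWithCornersSelf_coe, Set.range_id] at h'
    exact (contDiffWithinAt_univ.1 h').analyticAt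
  · intro z hz
    have hq : (extChartAt 𝓘(ℂ) q).symm z ∈ e.baseSet := by
      have := (extChartAt 𝓘(ℂ) q).map_target hz
      simpa [e, V, hom_trivializationAt_baseSet] using this
    exact (e.linearEquivAt ℂ _ hq).map_eq_zero_iff

/-- Identity theorem: a `1`-form vanishing near a point of a connected surface is zero. -/
theorem HolOneForm.eq_zero_of_eventually [PreconnectedSpace C] (η : HolOneForm C) (q : C)
    (hq : ∀ᶠ p in nhds q, η p = 0) : η = 0 := by
  -- The points where the germ of `η` vanishes form an open set; closedness comes from the isolation
  -- of zeros of analytic functions.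
  let S : Set C := {p | ∀ᶠ p' in nhds p, η p' = 0}
  have hopen : IsOpen S := isOpen_setOfPred_eventually_nhds
  have hclosed : IsClosed S := by
    refine isClosed_of_closure_subset fun p hp => ?_
    obtain ⟨k, hk, hk'⟩ := η.exists_analyticAt p
    have hsymm : Filter.Tendsto (extChartAt 𝓘(ℂ) p).symm (nhds (extChartAt 𝓘(ℂ) p p)) (nhds p) := by
      have := continuousAt_extChartAt_symm (I := 𝓘(ℂ)) p
      rwa [ContinuousAt, extChartAt_to_inv] at this
    have hmap : Filter.Tendsto (extChartAt 𝓘(ℂ) p) (nhds p) (nhds (extChartAt 𝓘(ℂ) p p)) :=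
      continuousAt_extChartAt (I := 𝓘(ℂ)) p
    have hsrc := extChartAt_source_mem_nhds (I := 𝓘(ℂ)) p
    have htgt := extChartAt_target_mem_nhds (I := 𝓘(ℂ)) p
    rcases hk.eventually_eq_zero_or_eventually_ne_zero with h0 | h0
    · filter_upwards [hmap.eventually h0, hsrc] with p' hp' hs
      have := (hk' _ ((extChartAt 𝓘(ℂ) p).map_source hs)).1 hp'
      rwa [(extChartAt 𝓘(ℂ) p).left_inv hs] at this
    · exfalso
      have h1 : ∀ᶠ p' in nhds p, p' ≠ p → η p' ≠ 0 := by
        filter_upwards [hmap.eventually (eventually_nhdsWithin_iff.1 h0), hsrc] with p' hp' hs hne h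
        refine hp' (fun he => hne ((extChartAt 𝓘(ℂ) p).injOn hs (mem_extChartAt_source p) he)) ?_
        rw [hk' _ ((extChartAt 𝓘(ℂ) p).map_source hs), (extChartAt 𝓘(ℂ) p).left_inv hs]
        exact h
      obtain ⟨p', hp'S, hp'⟩ := ((mem_closure_iff_frequently.1 hp).and_eventually
        (h1.eventually_nhds)).exists
      -- Near `p'` the form vanishes, yet it is non-zero off `p`; so `p'` would be an isolated
      -- point, which a chart to `ℂ` forbids.
      have h2 : ∀ᶠ r in nhds p', r = p := by
        filter_upwards [hp', hp'S] with r hr hr' using by_contra fun hne => hr hne hr'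
      have h3 : p' = p := h2.self_of_nhds
      subst h3
      have h4 : ∀ᶠ z in nhds (extChartAt 𝓘(ℂ) p' p'), z = extChartAt 𝓘(ℂ) p' p' := by
        filter_upwards [hsymm.eventually h2, htgt] with z hz ht
        rw [← (extChartAt 𝓘(ℂ) p').right_inv ht, hz]
      have h5 : ∃ᶠ z in nhdsWithin (extChartAt 𝓘(ℂ) p' p') {extChartAt 𝓘(ℂ) p' p'}ᶜ, True :=
        Filter.frequently_true_iff_neBot _ |>.2 inferInstance
      obtain ⟨z, -, hz1, hz2⟩ := (h5.and_eventually
        ((h4.filter_mono nhdsWithin_le_nhds).and self_mem_nhdsWithin)).exists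
      exact hz2 hz1
  have huniv : S = Set.univ := IsClopen.eq_univ ⟨hclosed, hopen⟩ ⟨q, hq⟩
  ext1 p
  exact (huniv ▸ Set.mem_univ p : p ∈ S).self_of_nhds

end OneForm

/-! ### Holomorphic maps that kill a 1-form -/

section Pullback

variable {X C : Type*} [TopologicalSpace X] [ChartedSpace ℂ X] [IsManifold 𝓘(ℂ) ω X]
  [TopologicalSpace C] [ChartedSpace ℂ C] [IsManifold 𝓘(ℂ) ω C]

/-- A holomorphic map is near each point either constant, or open with non-vanishing derivative
arbitrarily close to the point. -/
theorem eventually_const_or_exists_map_nhds {h : X → C} (hh : ContMDiff 𝓘(ℂ) 𝓘(ℂ) ω h) (x : X) :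
    (∀ᶠ x' in nhds x, h x' = h x) ∨ ∃ x₀ : X, Filter.map h (nhds x₀) = nhds (h x₀) ∧
      ∀ᶠ x' in nhds x₀, mfderiv 𝓘(ℂ) 𝓘(ℂ) h x' ≠ 0 := by
  let e := chartAt ℂ x
  let e' := chartAt ℂ (h x)
  let f : ℂ → ℂ := fun z => e' (h (e.symm z))
  let U : Set ℂ := e.target ∩ e.symm ⁻¹' (h ⁻¹' e'.source)
  have hU : IsOpen U := e.symm.isOpen_inter_preimage (e'.open_source.preimage hh.continuous)
  have hxU : e x ∈ U := by
    refine ⟨e.map_source (mem_chart_source ℂ x), ?_⟩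
    simp only [Set.mem_preimage, e.left_inv (mem_chart_source ℂ x)]
    exact mem_chart_source ℂ (h x)
  have hsymm : ∀ z ∈ U, ContMDiffAt 𝓘(ℂ) 𝓘(ℂ) ω (fun z => h (e.symm z)) z := fun z hz =>
    (hh _).comp z ((contMDiffOn_chart_symm (I := 𝓘(ℂ)) (n := ω) (x := x)).contMDiffAt
      (e.open_target.mem_nhds hz.1))
  have hf : ∀ z ∈ U, AnalyticAt ℂ f z := fun z hz =>
    (contMDiffAt_iff_contDiffAt.1 <| ContMDiffAt.comp (g := e') z
      ((contMDiffOn_chart (I := 𝓘(ℂ)) (n := ω) (x := h x)).contMDiffAt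
      (e'.open_source.mem_nhds hz.2)) (hsymm z hz)).analyticAt
  have hder : ∀ z ∈ U, deriv f z ≠ 0 → mfderiv 𝓘(ℂ) 𝓘(ℂ) h (e.symm z) ≠ 0 := by
    intro z hz hne h0
    refine hne ?_
    have hd : HasMFDerivAt 𝓘(ℂ) 𝓘(ℂ) h (e.symm z) 0 :=
      h0 ▸ ((hh _).mdifferentiableAt (by simp)).hasMFDerivAt
    have hd₁ := ((contMDiffOn_chart_symm (I := 𝓘(ℂ)) (n := ω) (x := x)).contMDiffAt
      (e.open_target.mem_nhds hz.1)).mdifferentiableAt (by simp) |>.hasMFDerivAt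
    have hd₂ := ((contMDiffOn_chart (I := 𝓘(ℂ)) (n := ω) (x := h x)).contMDiffAt
      (e'.open_source.mem_nhds hz.2)).mdifferentiableAt (by simp) |>.hasMFDerivAt
    have h3 := hd₂.comp z (hd.comp z hd₁)
    rw [ContinuousLinearMap.zero_comp, ContinuousLinearMap.comp_zero] at h3
    have h4 : HasFDerivAt f (0 : ℂ →L[ℂ] ℂ) z := hasMFDerivAt_iff_hasFDerivAt.1 h3
    simpa using h4.hasDerivAt.deriv
  -- Either the derivative in charts vanishes on a ball, making `f` constant there, or it is
  -- non-zero at some nearby point, where the inverse function theorem applies.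
  by_cases hc : ∀ᶠ z in nhds (e x), deriv f z = 0
  · left
    obtain ⟨r, hr, hball⟩ := Metric.eventually_nhds_iff_ball.1 (hc.and (hU.mem_nhds hxU))
    have hconst : ∀ᶠ z in nhds (e x), f z = f (e x) := by
      filter_upwards [Metric.ball_mem_nhds (e x) hr] with z hz
      exact Metric.isOpen_ball.is_const_of_deriv_eq_zero (convex_ball _ _).isPreconnected
        (fun w hw => (hf w (hball w hw).2).differentiableAt.differentiableWithinAt)
        (fun w hw => (hball w hw).1) hz (Metric.mem_ball_self hr)
    have hcont : Filter.Tendsto e (nhds x) (nhds (e x)) :=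
      e.continuousAt (mem_chart_source ℂ x)
    filter_upwards [hcont.eventually hconst, hcont.eventually (hU.mem_nhds hxU),
      e.open_source.mem_nhds (mem_chart_source ℂ x)] with x' h1 h2 h3
    have h4 : h x' ∈ e'.source := by
      have := h2.2
      simpa only [Set.mem_preimage, e.left_inv h3] using this
    refine e'.injOn h4 (mem_chart_source ℂ (h x)) ?_
    simpa only [f, e.left_inv h3, e.left_inv (mem_chart_source ℂ x)] using h1
  · right
    obtain ⟨z, hz, hzU⟩ := ((Filter.not_eventually.1 hc).and_eventually (hU.mem_nhds hxU)).exists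
    have hcont : Filter.Tendsto e (nhds (e.symm z)) (nhds z) := by
      have := e.continuousAt (e.map_target hzU.1)
      rwa [ContinuousAt, e.right_inv hzU.1] at this
    have hmap_e : Filter.map e.symm (nhds z) = nhds (e.symm z) := e.symm.map_nhds_eq hzU.1
    have hmap_e' : Filter.map e'.symm (nhds (f z)) = nhds (h (e.symm z)) := by
      rw [e'.symm.map_nhds_eq (e'.map_source hzU.2), e'.left_inv hzU.2]
    have hmap_f : Filter.map f (nhds z) = nhds (f z) :=
      ((hf z hzU).hasStrictDerivAt).map_nhds_eq hz
    refine ⟨e.symm z, ?_, ?_⟩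
    · rw [← hmap_e', ← hmap_f, ← hmap_e, Filter.map_map, Filter.map_map]
      refine Filter.map_congr ?_
      filter_upwards [hU.mem_nhds hzU] with w hw
      exact (e'.left_inv hw.2).symm
    · rw [← hmap_e, Filter.eventually_map]
      filter_upwards [hU.mem_nhds hzU, (hf z hzU).deriv.continuousAt.eventually_ne hz] with w hw hw'
      exact hder w hw hw'

/-- A holomorphic map to a connected Riemann surface that pulls back a non-zero `1`-form to zero
is constant. -/
theorem apply_eq_of_pullback_eq_zero [PreconnectedSpace X] [PreconnectedSpace C] {h : X → C}
    (hh : ContMDiff 𝓘(ℂ) 𝓘(ℂ) ω h) {η : HolOneForm C} (hη : η ≠ 0)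
    (h0 : ∀ v, η.eval (tangentMap 𝓘(ℂ) 𝓘(ℂ) h v) = 0) (x x' : X) : h x = h x' := by
  refine IsLocallyConstant.apply_eq_of_preconnectedSpace ?_ x x'
  refine (IsLocallyConstant.iff_eventually_eq h).2 fun x => ?_
  refine (eventually_const_or_exists_map_nhds hh x).resolve_right ?_
  rintro ⟨x₀, hmap, hne⟩
  refine hη (η.eq_zero_of_eventually (h x₀) ?_)
  rw [← hmap, Filter.eventually_map]
  filter_upwards [hne] with x' hx'
  let L : ℂ →L[ℂ] ℂ := mfderiv 𝓘(ℂ) 𝓘(ℂ) h x'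
  let T : ℂ →L[ℂ] ℂ := η (h x')
  obtain ⟨v, hv⟩ : ∃ v, L v ≠ 0 := by
    by_contra! hcon
    exact hx' (ContinuousLinearMap.ext hcon)
  have h1 : T (L v) = 0 := h0 ⟨x', v⟩
  -- The tangent space is a line, so the non-zero vector `L v` spans it.
  have h2 : T = 0 := by
    ext
    rw [← div_mul_cancel₀ 1 hv, ← smul_eq_mul, map_smul, h1, smul_zero,
      zero_apply]
  exact h2

end Pullback

/-! ### Rigidity of maps from products to curves of genus at least two -/

section Rigidity

variable {X Y C : Type*}
  [TopologicalSpace X] [ChartedSpace ℂ X] [IsManifold 𝓘(ℂ) ω X]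
  [TopologicalSpace Y] [ChartedSpace ℂ Y] [IsManifold 𝓘(ℂ) ω Y]
  [TopologicalSpace C] [ChartedSpace ℂ C] [IsManifold 𝓘(ℂ) ω C]

/-- The pullback of a `1`-form along the partial maps `f(x, ·)` does not depend on `x`. -/
theorem eval_tangentMap_eq [CompactSpace X] [PreconnectedSpace X] {f : X × Y → C}
    (hf : ContMDiff (𝓘(ℂ).prod 𝓘(ℂ)) 𝓘(ℂ) ω f) (η : HolOneForm C)
    (v : TangentBundle 𝓘(ℂ) Y) (x x' : X) :
    η.eval (tangentMap 𝓘(ℂ) 𝓘(ℂ) (fun y => f (x, y)) v) =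
      η.eval (tangentMap 𝓘(ℂ) 𝓘(ℂ) (fun y => f (x', y)) v) := by
  -- Attaching the zero vector at `x` to `v` gives a holomorphic family of tangent vectors of `X ×
  -- Y`; `F` is then holomorphic on a compact connected curve, hence constant.
  let F : X → ℂ := fun x => η.eval (tangentMap (𝓘(ℂ).prod 𝓘(ℂ)) 𝓘(ℂ) f
    ((equivTangentBundleProd 𝓘(ℂ) X 𝓘(ℂ) Y).symm
      (Bundle.zeroSection ℂ (TangentSpace 𝓘(ℂ)) x, v)))
  have hF : ContMDiff 𝓘(ℂ) 𝓘(ℂ) ω F :=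
    η.contMDiff_eval.comp <| (hf.contMDiff_tangentMap (m := ω) le_rfl).comp <|
      contMDiff_equivTangentBundleProd_symm.comp <|
        (Bundle.contMDiff_zeroSection ℂ (TangentSpace 𝓘(ℂ) (M := X))).prodMk contMDiff_const
  have key : ∀ x, η.eval (tangentMap 𝓘(ℂ) 𝓘(ℂ) (fun y => f (x, y)) v) = F x := by
    intro x
    have h1 : tangentMap 𝓘(ℂ) 𝓘(ℂ) (fun y => f (x, y)) v =
        tangentMap (𝓘(ℂ).prod 𝓘(ℂ)) 𝓘(ℂ) f
          (tangentMap 𝓘(ℂ) (𝓘(ℂ).prod 𝓘(ℂ)) (fun y : Y => (x, y)) v) :=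
      tangentMap_comp_at v ((hf _).mdifferentiableAt (by simp))
        ((contMDiff_const.prodMk contMDiff_id : ContMDiff 𝓘(ℂ) (𝓘(ℂ).prod 𝓘(ℂ)) ω fun y : Y => (x, y))
          |>.mdifferentiableAt (by simp))
    rw [h1, tangentMap_prod_right]
    rfl
  rw [key, key]
  exact (hF.mdifferentiable (by simp)).apply_eq_of_compactSpace x x'

/-- A holomorphic map from a product of two compact connected Riemann surfaces to a Riemann surface
of genus at least two depends on one variable only. -/
theorem apply_eq_or_apply_eq [CompactSpace X] [PreconnectedSpace X] [CompactSpace Y]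
    [PreconnectedSpace Y] [PreconnectedSpace C] (hC : 2 ≤ genus C) {f : X × Y → C}
    (hf : ContMDiff (𝓘(ℂ).prod 𝓘(ℂ)) 𝓘(ℂ) ω f) :
    (∀ x x' y, f (x, y) = f (x', y)) ∨ ∀ x y y', f (x, y) = f (x, y') := by
  obtain ⟨η, hη⟩ : ∃ η : Fin 2 → HolOneForm C, LinearIndependent ℂ η :=
    exists_linearIndependent_of_le_finrank hC
  have hf₁ : ∀ x, ContMDiff 𝓘(ℂ) 𝓘(ℂ) ω fun y => f (x, y) :=
    fun x => hf.comp (contMDiff_const.prodMk contMDiff_id)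
  have hf₂ : ∀ y, ContMDiff 𝓘(ℂ) 𝓘(ℂ) ω fun x => f (x, y) :=
    fun y => hf.comp (contMDiff_id.prodMk contMDiff_const)
  have hf' : ContMDiff (𝓘(ℂ).prod 𝓘(ℂ)) 𝓘(ℂ) ω fun p : Y × X => f (p.2, p.1) :=
    hf.comp (contMDiff_snd.prodMk contMDiff_fst)
  by_cases hv : ∀ x v, (η 0).eval (tangentMap 𝓘(ℂ) 𝓘(ℂ) (fun y => f (x, y)) v) = 0
  · exact Or.inr fun x => apply_eq_of_pullback_eq_zero (hf₁ x) (hη.ne_zero 0) (hv x)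
  · left
    push Not at hv
    obtain ⟨x₀, ⟨y₀, v⟩, hv⟩ := hv
    let b : Fin 2 → ℂ := fun i =>
      (η i).eval (tangentMap 𝓘(ℂ) 𝓘(ℂ) (fun y => f (x₀, y)) ⟨y₀, v⟩)
    -- The combination of the two forms that kills the `y`-derivative at `(x, y₀)`. Since `b` does
    -- not depend on `x`, the same `θ` serves for all `x`.
    let θ : HolOneForm C := b 0 • η 1 - b 1 • η 0
    have hθ : θ ≠ 0 := by
      intro h0
      refine hv (Fintype.linearIndependent_iff.1 hη ![-b 1, b 0] ?_ 1)
      rw [← h0, Fin.sum_univ_two]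
      simp only [θ, Matrix.cons_val_zero, Matrix.cons_val_one]
      module
    have hθ0 : ∀ w, θ.eval (tangentMap 𝓘(ℂ) 𝓘(ℂ) (fun x => f (x, y₀)) w) = 0 := by
      rintro ⟨x, w⟩
      have hb : ∀ i, b i = (η i).eval (tangentMap 𝓘(ℂ) 𝓘(ℂ) (fun y => f (x, y)) ⟨y₀, v⟩) :=
        fun i => eval_tangentMap_eq hf (η i) ⟨y₀, v⟩ x₀ x
      let L₁ : ℂ →L[ℂ] ℂ := mfderiv 𝓘(ℂ) 𝓘(ℂ) (fun y => f (x, y)) y₀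
      let L₂ : ℂ →L[ℂ] ℂ := mfderiv 𝓘(ℂ) 𝓘(ℂ) (fun x => f (x, y₀)) x
      let T : Fin 2 → ℂ →L[ℂ] ℂ := fun i => η i (f (x, y₀))
      have hT : ∀ i z, T i z = z * T i 1 := fun i z => by
        rw [← smul_eq_mul, ← map_smul, smul_eq_mul, mul_one]
      have h1 : ∀ i, b i = T i (L₁ v) := hb
      -- Two functionals on a line have vanishing determinant, so `θ` kills the whole tangent line
      -- at `f (x, y₀)`, in particular the `x`-derivative.
      have h2 : ∀ s t : ℂ, T 0 s * T 1 t - T 1 s * T 0 t = 0 := fun s t => by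
        rw [hT 0 s, hT 1 s, hT 0 t, hT 1 t]
        ring
      change b 0 * T 1 (L₂ w) - b 1 * T 0 (L₂ w) = 0
      rw [h1, h1]
      exact h2 _ _
    have hconst := apply_eq_of_pullback_eq_zero (hf₂ y₀) hθ hθ0
    intro x x' y
    refine apply_eq_of_pullback_eq_zero (hf₂ y) (hη.ne_zero 0) (fun w => ?_) x x'
    -- The pullback along `f(·, y)` is independent of `y`, and at `y₀` the slice is already known to
    -- be constant.
    rw [eval_tangentMap_eq hf' (η 0) w y y₀]
    have : (fun x => f (x, y₀)) = fun _ => f (x₀, y₀) := funext fun x => hconst x x₀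
    change (η 0).eval (tangentMap 𝓘(ℂ) 𝓘(ℂ) (fun x => f (x, y₀)) w) = 0
    rw [this]
    simp only [tangentMap, mfderiv_const]
    exact map_zero _

/-- The three coordinates of a point. -/
def coord (i : Fin 3) (p : C × C × C) : C := ![p.1, p.2.1, p.2.2] i

/-- Apply the two-variable result to slices. If `f` varies with the first variable anywhere, that
variation excludes the others; otherwise freeze the first variable and compare the last two. -/
theorem exists_coord_dependence [CompactSpace C] [PreconnectedSpace C] (hC : 2 ≤ genus C)
    {f : C × C × C → C} (hf : ContMDiff (𝓘(ℂ).prod (𝓘(ℂ).prod 𝓘(ℂ))) 𝓘(ℂ) ω f) :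
    ∃ j : Fin 3, ∀ p q, coord j p = coord j q → f p = f q := by
  have hxy : ∀ z, (∀ x x' y, f (x, y, z) = f (x', y, z)) ∨ ∀ x y y', f (x, y, z) = f (x, y', z) :=
    fun z => apply_eq_or_apply_eq hC (f := fun p : C × C => f (p.1, p.2, z))
      (hf.comp (contMDiff_fst.prodMk (contMDiff_snd.prodMk contMDiff_const)))
  have hxz : ∀ y, (∀ x x' z, f (x, y, z) = f (x', y, z)) ∨ ∀ x z z', f (x, y, z) = f (x, y, z') :=
    fun y => apply_eq_or_apply_eq hC (f := fun p : C × C => f (p.1, y, p.2))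
      (hf.comp (contMDiff_fst.prodMk (contMDiff_const.prodMk contMDiff_snd)))
  have hyz : ∀ x, (∀ y y' z, f (x, y, z) = f (x, y', z)) ∨ ∀ y z z', f (x, y, z) = f (x, y, z') :=
    fun x => apply_eq_or_apply_eq hC (f := fun p : C × C => f (x, p.1, p.2))
      (hf.comp (contMDiff_const.prodMk (contMDiff_fst.prodMk contMDiff_snd)))
  by_cases hx : ∀ x x' y z, f (x, y, z) = f (x', y, z)
  · by_cases hy : ∀ x y y' z, f (x, y, z) = f (x, y', z)
    · refine ⟨2, ?_⟩
      rintro ⟨x, y, z⟩ ⟨x', y', _⟩ rfl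
      exact (hx x x' y _).trans (hy x' y y' _)
    · refine ⟨1, ?_⟩
      push Not at hy
      obtain ⟨x₀, y₀, y₁, z₀, hy⟩ := hy
      have h1 := (hyz x₀).resolve_left fun h => hy (h _ _ _)
      rintro ⟨x, y, z⟩ ⟨x', _, z'⟩ rfl
      exact (hx x x₀ _ z).trans ((h1 _ z z').trans (hx x₀ x' _ z'))
  · refine ⟨0, ?_⟩
    push Not at hx
    obtain ⟨x₀, x₁, y₀, z₀, hx⟩ := hx
    -- At height `z₀` the value does not depend on `y`, so the variation between `x₀` and `x₁`
    -- occurs at every `y`; this then rules out dependence on `z` for each `y`.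
    have h1 := (hxy z₀).resolve_left fun h => hx (h _ _ _)
    have h2 : ∀ y x z z', f (x, y, z) = f (x, y, z') := fun y =>
      (hxz y).resolve_left fun h => hx (by rw [h1 x₀ y₀ y, h1 x₁ y₀ y]; exact h _ _ _)
    rintro ⟨x, y, z⟩ ⟨_, y', z'⟩ rfl
    exact (h2 y _ z z₀).trans ((h1 _ y y').trans (h2 y' _ z₀ z'))

end Rigidity

/-- A chart target is a non-empty open subset of `ℂ`, hence not a single point. Two distinct points
are needed to tell coordinates apart. -/
theorem nontrivial_of_chartedSpace (C : Type*) [TopologicalSpace C] [ChartedSpace ℂ C]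
    [Nonempty C] : Nontrivial C := by
  let e := chartAt ℂ (Classical.arbitrary C)
  have h0 : e (Classical.arbitrary C) ∈ e.target := e.map_source (mem_chart_source ℂ _)
  obtain ⟨z, hz, hne⟩ : ∃ z ∈ e.target, z ≠ e (Classical.arbitrary C) := by
    have h : ∀ᶠ z in nhdsWithin (e (Classical.arbitrary C)) {e (Classical.arbitrary C)}ᶜ,
        z ∈ e.target ∧ z ≠ e (Classical.arbitrary C) :=
      (Filter.Eventually.filter_mono nhdsWithin_le_nhds (e.open_target.mem_nhds h0)).and
        self_mem_nhdsWithin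
    exact h.exists
  exact ⟨⟨e.symm z, e.symm _, fun h => hne (e.symm.injOn hz h0 h)⟩⟩

/-! ### Splitting an automorphism along a product -/

section Split

variable {E H M : Type*} [NormedAddCommGroup E] [NormedSpace ℂ E] [TopologicalSpace H]
  {I : ModelWithCorners ℂ E H} [TopologicalSpace M] [ChartedSpace H M]
  {E₁ H₁ A : Type*} [NormedAddCommGroup E₁] [NormedSpace ℂ E₁] [TopologicalSpace H₁]
  {I₁ : ModelWithCorners ℂ E₁ H₁} [TopologicalSpace A] [ChartedSpace H₁ A]
  {E₂ H₂ B : Type*} [NormedAddCommGroup E₂] [NormedSpace ℂ E₂] [TopologicalSpace H₂]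
  {I₂ : ModelWithCorners ℂ E₂ H₂} [TopologicalSpace B] [ChartedSpace H₂ B]

/-- A biholomorphic map `g` of `A × B` splits as soon as the components of `g` and `g⁻¹` depend on
the respective variable only. -/
theorem mem_splitSubgroup_of_dependence [Nonempty A] [Nonempty B]
    (e : Diffeomorph I (I₁.prod I₂) M (A × B) ω) (g : Diffeomorph I I M M ω)
    (h₁ : ∀ p q, (e p).1 = (e q).1 → (e (g p)).1 = (e (g q)).1)
    (h₁' : ∀ p q, (e p).1 = (e q).1 → (e (g⁻¹ p)).1 = (e (g⁻¹ q)).1)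
    (h₂ : ∀ p q, (e p).2 = (e q).2 → (e (g p)).2 = (e (g q)).2)
    (h₂' : ∀ p q, (e p).2 = (e q).2 → (e (g⁻¹ p)).2 = (e (g⁻¹ q)).2) :
    g ∈ splitSubgroup (I := I) I₁ I₂ e.toEquiv := by
  obtain ⟨a₀⟩ := ‹Nonempty A›
  obtain ⟨b₀⟩ := ‹Nonempty B›
  -- Resetting the second component to `b₀` between `g'` and `g` is harmless, since the first
  -- component of `g` ignores it; hence the slices of `g` and `g⁻¹` are mutually inverse.
  have hA : ∀ (g g' : Diffeomorph I I M M ω), (∀ m, g (g' m) = m) →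
      (∀ p q, (e p).1 = (e q).1 → (e (g p)).1 = (e (g q)).1) → ∀ a,
      (e (g (e.symm ((e (g' (e.symm (a, b₀)))).1, b₀)))).1 = a := by
    intro g g' hgg' h a
    rw [h _ (g' (e.symm (a, b₀))) (by simp), hgg']
    simp
  have hB : ∀ (g g' : Diffeomorph I I M M ω), (∀ m, g (g' m) = m) →
      (∀ p q, (e p).2 = (e q).2 → (e (g p)).2 = (e (g q)).2) → ∀ b,
      (e (g (e.symm (a₀, (e (g' (e.symm (a₀, b)))).2)))).2 = b := by
    intro g g' hgg' h b
    rw [h _ (g' (e.symm (a₀, b))) (by simp), hgg']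
    simp
  have sA : ∀ g : Diffeomorph I I M M ω,
      ContMDiff I₁ I₁ ω fun a => (e (g (e.symm (a, b₀)))).1 := fun g =>
    contMDiff_fst.comp <| e.contMDiff.comp <| g.contMDiff.comp <| e.symm.contMDiff.comp <|
      contMDiff_id.prodMk contMDiff_const
  have sB : ∀ g : Diffeomorph I I M M ω,
      ContMDiff I₂ I₂ ω fun b => (e (g (e.symm (a₀, b)))).2 := fun g =>
    contMDiff_snd.comp <| e.contMDiff.comp <| g.contMDiff.comp <| e.symm.contMDiff.comp <|
      contMDiff_const.prodMk contMDiff_id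
  let φ : Diffeomorph I₁ I₁ A A ω :=
    { toFun := fun a => (e (g (e.symm (a, b₀)))).1
      invFun := fun a => (e (g⁻¹ (e.symm (a, b₀)))).1
      left_inv := hA g⁻¹ g (inv_apply_self g) h₁'
      right_inv := hA g g⁻¹ (apply_inv_self g) h₁
      contMDiff_toFun := sA g
      contMDiff_invFun := sA g⁻¹ }
  let F : Diffeomorph I₂ I₂ B B ω :=
    { toFun := fun b => (e (g (e.symm (a₀, b)))).2
      invFun := fun b => (e (g⁻¹ (e.symm (a₀, b)))).2
      left_inv := hB g⁻¹ g (inv_apply_self g) h₂'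
      right_inv := hB g g⁻¹ (apply_inv_self g) h₂
      contMDiff_toFun := sB g
      contMDiff_invFun := sB g⁻¹ }
  refine ⟨φ, F,
    fun m => Prod.ext (h₁ _ _ ?_) (h₂ _ _ ?_)⟩
  · exact (congrArg Prod.fst (e.apply_symm_apply ((e m).1, b₀))).symm
  · exact (congrArg Prod.snd (e.apply_symm_apply (a₀, (e m).2))).symm

end Split

/-! ### Diagonal elements and restriction of twisted conjugates -/

section Factors

variable {C₁ C₂ C₃ : Type*}
  [TopologicalSpace C₁] [ChartedSpace ℂ C₁] [TopologicalSpace C₂] [ChartedSpace ℂ C₂]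
  [TopologicalSpace C₃] [ChartedSpace ℂ C₃]

theorem prodThree_mem_splitSubgroup₁ (a : AutCurve C₁) (b : AutCurve C₂) (c : AutCurve C₃) :
    prodThree a b c ∈ splitSubgroup 𝓘(ℂ) (𝓘(ℂ).prod 𝓘(ℂ)) splitting₁ :=
  ⟨a, b.prodCongr c, fun _ => rfl⟩

theorem prodThree_mem_splitSubgroup₂ (a : AutCurve C₁) (b : AutCurve C₂) (c : AutCurve C₃) :
    prodThree a b c ∈ splitSubgroup 𝓘(ℂ) (𝓘(ℂ).prod 𝓘(ℂ)) splitting₂ :=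
  ⟨b, a.prodCongr c, fun _ => rfl⟩

theorem prodThree_mem_splitSubgroup₃ (a : AutCurve C₁) (b : AutCurve C₂) (c : AutCurve C₃) :
    prodThree a b c ∈ splitSubgroup 𝓘(ℂ) (𝓘(ℂ).prod 𝓘(ℂ)) splitting₃ :=
  ⟨c, a.prodCongr b, fun _ => rfl⟩

theorem diagonal_le_factor₁ (G : Subgroup (AutThree C₁ C₂ C₃)) : diagonal G ≤ factor₁ G := by
  rintro _ ⟨hg, a, b, c, rfl⟩
  exact ⟨hg, prodThree_mem_splitSubgroup₁ a b c⟩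

theorem diagonal_le_factor₂ (G : Subgroup (AutThree C₁ C₂ C₃)) : diagonal G ≤ factor₂ G := by
  rintro _ ⟨hg, a, b, c, rfl⟩
  exact ⟨hg, prodThree_mem_splitSubgroup₂ a b c⟩

theorem diagonal_le_factor₃ (G : Subgroup (AutThree C₁ C₂ C₃)) : diagonal G ≤ factor₃ G := by
  rintro _ ⟨hg, a, b, c, rfl⟩
  exact ⟨hg, prodThree_mem_splitSubgroup₃ a b c⟩

/-- Evaluating at `v p` cancels `v⁻¹`, so no formula for an inverse is ever needed. Allowing `u ≠ v`
covers the mixed products such as `τ f τ⁻²`. -/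
theorem ψ₁_mul_inv_apply [Nonempty C₂] [Nonempty C₃] {G : Subgroup (AutThree C₁ C₂ C₃)}
    {u f v : AutThree C₁ C₂ C₃} (h : u * f * v⁻¹ ∈ factor₁ G) (p : C₁ × C₂ × C₃) :
    ψ₁ G ⟨u * f * v⁻¹, h⟩ (v p).1 = (u (f p)).1 := by
  rw [ψ₁_apply]
  simp only [mul_apply, inv_apply_self]

theorem ψ₂_mul_inv_apply [Nonempty C₁] [Nonempty C₃] {G : Subgroup (AutThree C₁ C₂ C₃)}
    {u f v : AutThree C₁ C₂ C₃} (h : u * f * v⁻¹ ∈ factor₂ G) (p : C₁ × C₂ × C₃) :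
    ψ₂ G ⟨u * f * v⁻¹, h⟩ (v p).2.1 = (u (f p)).2.1 := by
  rw [ψ₂_apply]
  simp only [mul_apply, inv_apply_self]

end Factors

/-! ### Invariance under conjugation by product maps -/

section Conjugation

variable {X Y Z X' Y' Z' : Type*}
  [TopologicalSpace X] [ChartedSpace ℂ X] [TopologicalSpace Y] [ChartedSpace ℂ Y]
  [TopologicalSpace Z] [ChartedSpace ℂ Z] [TopologicalSpace X'] [ChartedSpace ℂ X']
  [TopologicalSpace Y'] [ChartedSpace ℂ Y'] [TopologicalSpace Z'] [ChartedSpace ℂ Z']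

theorem conj_symm_conj {E H M : Type*} [NormedAddCommGroup E] [NormedSpace ℂ E]
    [TopologicalSpace H] {I : ModelWithCorners ℂ E H} [TopologicalSpace M] [ChartedSpace H M]
    {E' H' M' : Type*} [NormedAddCommGroup E'] [NormedSpace ℂ E'] [TopologicalSpace H']
    {I' : ModelWithCorners ℂ E' H'} [TopologicalSpace M'] [ChartedSpace H' M']
    (ξ : Diffeomorph I I' M M' ω) (g : Diffeomorph I I M M ω) : conj ξ.symm (conj ξ g) = g :=
  Diffeomorph.ext fun x => by
    change ξ.symm (ξ (g (ξ.symm (ξ x)))) = g x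
    simp only [Diffeomorph.symm_apply_apply]

/-- Conjugating a product map by a product map acts factor by factor, and this is reversible. -/
theorem diagonal_map_conj_prodThree (a : CurveIso X X') (b : CurveIso Y Y') (c : CurveIso Z Z')
    (G : Subgroup (AutThree X Y Z)) :
    diagonal (G.map (conj (prodThree a b c))) = (diagonal G).map (conj (prodThree a b c)) := by
  ext k
  constructor
  · rintro ⟨⟨g, hg, rfl⟩, f', g', h', heq⟩
    refine ⟨g, ⟨hg, conj a.symm f', conj b.symm g', conj c.symm h', ?_⟩, rfl⟩
    rw [← conj_symm_conj (prodThree a b c) g, heq]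
    rfl
  · rintro ⟨_, ⟨hg, f, g, h, rfl⟩, rfl⟩
    exact ⟨⟨_, hg, rfl⟩, conj a f, conj b g, conj c h, rfl⟩

theorem relIndex_diagonal_map_conj (a : CurveIso X X') (b : CurveIso Y Y') (c : CurveIso Z Z')
    (G : Subgroup (AutThree X Y Z)) :
    (diagonal (G.map (conj (prodThree a b c)))).relIndex (G.map (conj (prodThree a b c))) =
      (diagonal G).relIndex G := by
  rw [diagonal_map_conj_prodThree]
  exact Subgroup.relIndex_map_map_of_injective _ _
    (Function.LeftInverse.injective (conj_symm_conj (prodThree a b c)))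

end Conjugation

/-! ### Index two -/

section IndexTwo

variable {D C : Type*} [TopologicalSpace D] [ChartedSpace ℂ D]
  [TopologicalSpace C] [ChartedSpace ℂ C] [Nonempty D] [Nonempty C]

/-- Conjugation by `δ` sends `(f, g, h)` to `(a f a⁻¹, h, d g d⁻¹)`, so the third component becomes
the second. -/
theorem isNormalFormTwo {G : Subgroup (AutThree D C C)} (hG : (diagonal G).relIndex G = 2)
    {δ : AutThree D C C} (hδG : δ ∈ G) (a : AutCurve D) (d : AutCurve C)
    (hδ : ∀ x y z, δ (x, y, z) = (a x, z, d y)) : IsNormalFormTwo G δ := by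
  have : Nontrivial C := nontrivial_of_chartedSpace C
  have hconj : ∀ g ∈ diagonal G, δ * g * δ⁻¹ ∈ diagonal G := by
    rintro _ ⟨hg, f, g, h, rfl⟩
    refine ⟨G.mul_mem (G.mul_mem hδG hg) (G.inv_mem hδG), a * f * a⁻¹, h, d * g * d⁻¹, ?_⟩
    rw [mul_inv_eq_iff_eq_mul]
    refine Diffeomorph.ext fun ⟨x, y, z⟩ => ?_
    simp only [mul_apply, prodThree_apply, hδ, inv_apply_self]
  have hδ₁ : δ ∈ factor₁ G := ⟨hδG, a,
    (Diffeomorph.prodComm 𝓘(ℂ) 𝓘(ℂ) C C ω).trans ((Diffeomorph.refl 𝓘(ℂ) C ω).prodCongr d),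
    fun ⟨x, y, z⟩ => hδ x y z⟩
  have hδ₂ : δ ^ 2 ∈ factor₂ G := by
    refine diagonal_le_factor₂ G ⟨G.pow_mem hδG 2, a * a, d, d, ?_⟩
    refine Diffeomorph.ext fun ⟨x, y, z⟩ => ?_
    simp only [pow_two, mul_apply, prodThree_apply, hδ]
  have hδ_notMem : δ ∉ diagonal G := by
    rintro ⟨-, f, g, h, rfl⟩
    obtain ⟨z, z', hz⟩ := exists_pair_ne C
    obtain ⟨x⟩ := ‹Nonempty D›
    have h1 := hδ x z z
    have h2 := hδ x z z'
    simp only [prodThree_apply, Prod.mk.injEq] at h1 h2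
    exact hz (h1.2.1.symm.trans h2.2.1)
  refine ⟨fun g hg => ⟨diagonal_le_factor₃ G hg, diagonal_le_factor₂ G (hconj g hg),
    Diffeomorph.ext fun z => ?_⟩, ⟨hδ₁, hδ₂, fun x y z => ?_⟩,
    fun g hg => ⟨diagonal_le_factor₁ G hg, diagonal_le_factor₂ G hg,
      diagonal_le_factor₂ G (hconj g hg), fun x y z => ?_⟩, fun h hh => ?_⟩
  · let p : D × C × C := (Classical.arbitrary D, z, z)
    have h1 := ψ₃_apply G ⟨g, diagonal_le_factor₃ G hg⟩ p
    have h2 := ψ₂_mul_inv_apply (diagonal_le_factor₂ G (hconj g hg)) p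
    have h3 : ∀ q, (δ q).2.1 = q.2.2 := fun q => congrArg (·.2.1) (hδ q.1 q.2.1 q.2.2)
    rw [h3, h3] at h2
    exact h1.trans h2.symm
  · have h1 := ψ₁_apply G ⟨δ, hδ₁⟩ (x, y, z)
    have h2 := ψ₂_apply G ⟨δ ^ 2, hδ₂⟩ (x, y, z)
    simp only [pow_two, mul_apply, hδ] at h1 h2
    rw [hδ, ← h1]
    simp only [pow_two, h2]
  · have h1 := ψ₁_apply G ⟨g, diagonal_le_factor₁ G hg⟩ (x, y, z)
    have h2 := ψ₂_apply G ⟨g, diagonal_le_factor₂ G hg⟩ (x, y, z)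
    have h3 := ψ₂_mul_inv_apply (diagonal_le_factor₂ G (hconj g hg)) (x, y, z)
    have h4 : ∀ q, (δ q).2.1 = q.2.2 := fun q => congrArg (·.2.1) (hδ q.1 q.2.1 q.2.2)
    rw [h4, h4] at h3
    exact Prod.ext h1.symm (Prod.ext h2.symm h3.symm)
  · by_cases hd : h ∈ diagonal G
    · exact ⟨h, hd, Or.inl rfl⟩
    · refine ⟨δ⁻¹ * h, ?_, Or.inr (mul_inv_cancel_left δ h).symm⟩
      -- In an index two subgroup the product of two non-members is a member.
      have := (Subgroup.mul_mem_iff_of_index_two (H := (diagonal G).subgroupOf G) hG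
        (a := ⟨δ⁻¹, G.inv_mem hδG⟩) (b := ⟨h, hh⟩)).2
      simp only [Subgroup.mem_subgroupOf] at this
      exact this (iff_of_false (fun h' => hδ_notMem (inv_mem_iff.1 h')) hd)

end IndexTwo

/-! ### The permutation of factors induced by an automorphism -/

section Cube

theorem exists_coord_eq {C : Type*} (j : Fin 3) (u : C) (i : Fin 3) (p : C × C × C) (hij : i ≠ j) :
    ∃ q, coord j q = coord j p ∧ coord i q = u := by
  obtain ⟨x, y, z⟩ := p
  fin_cases i <;> fin_cases j
  all_goals first
    | exact absurd rfl hij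
    | exact ⟨(u, y, z), rfl, rfl⟩
    | exact ⟨(x, u, z), rfl, rfl⟩
    | exact ⟨(x, y, u), rfl, rfl⟩

theorem coord_surjective {C : Type*} [Nonempty C] (i : Fin 3) :
    Function.Surjective (coord i : C × C × C → C) := fun u =>
  ⟨(u, u, u), by fin_cases i <;> rfl⟩

theorem contMDiff_coord {C : Type*} [TopologicalSpace C] [ChartedSpace ℂ C] (i : Fin 3) :
    ContMDiff (𝓘(ℂ).prod (𝓘(ℂ).prod 𝓘(ℂ))) 𝓘(ℂ) ω (coord i : C × C × C → C) := by
  fin_cases i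
  exacts [contMDiff_fst, contMDiff_fst.comp contMDiff_snd, contMDiff_snd.comp contMDiff_snd]

variable {C : Type*} [TopologicalSpace C] [ChartedSpace ℂ C]

/-- The `i`-th coordinate of `g p` is determined by the `j`-th coordinate of `p`. -/
def CoordDependsOn (g : AutThree C C C) (i j : Fin 3) : Prop :=
  ∀ p q, coord j p = coord j q → coord i (g p) = coord i (g q)

theorem CoordDependsOn.mul {g h : AutThree C C C} {i j k : Fin 3} (hg : CoordDependsOn g i j)
    (hh : CoordDependsOn h j k) : CoordDependsOn (g * h) i k :=
  fun p q hpq => hg _ _ (hh p q hpq)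

/-- If two different input coordinates each determined the output alone, a point sharing one with
`p` and the other with `q` would force equal outputs, against surjectivity of `g`. -/
theorem CoordDependsOn.unique [Nonempty C] {g : AutThree C C C} {i j j' : Fin 3}
    (h : CoordDependsOn g i j) (h' : CoordDependsOn g i j') : j = j' := by
  by_contra hne
  have := nontrivial_of_chartedSpace C
  obtain ⟨u, v, huv⟩ := exists_pair_ne C
  obtain ⟨p, hp⟩ := coord_surjective i u
  obtain ⟨q, hq⟩ := coord_surjective i v
  obtain ⟨r, hr, hr'⟩ := exists_coord_eq j (coord j' (g⁻¹ q)) j' (g⁻¹ p) (Ne.symm hne)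
  have h1 := h _ _ hr
  have h2 := h' _ _ hr'
  rw [apply_inv_self] at h1 h2
  exact huv (by rw [← hp, ← hq, ← h1, ← h2])

theorem factor₁_coordDependsOn {G : Subgroup (AutThree C C C)} {g : AutThree C C C}
    (hg : g ∈ factor₁ G) : CoordDependsOn g 0 0 := by
  obtain ⟨-, φ, F, h⟩ := hg
  intro p q hpq
  exact (congrArg Prod.fst (h p)).trans ((congrArg φ hpq).trans (congrArg Prod.fst (h q)).symm)

theorem factor₂_coordDependsOn {G : Subgroup (AutThree C C C)} {g : AutThree C C C}
    (hg : g ∈ factor₂ G) : CoordDependsOn g 1 1 := by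
  obtain ⟨-, φ, F, h⟩ := hg
  intro p q hpq
  exact (congrArg Prod.fst (h p)).trans ((congrArg φ hpq).trans (congrArg Prod.fst (h q)).symm)

theorem factor₃_coordDependsOn {G : Subgroup (AutThree C C C)} {g : AutThree C C C}
    (hg : g ∈ factor₃ G) : CoordDependsOn g 2 2 := by
  obtain ⟨-, φ, F, h⟩ := hg
  intro p q hpq
  exact (congrArg Prod.fst (h p)).trans ((congrArg φ hpq).trans (congrArg Prod.fst (h q)).symm)

/-- The rearrangement `(x, y, z) ↦ (y, (x, z))` as a biholomorphic map. -/
def splitDiffeo₂ : Diffeomorph (𝓘(ℂ).prod (𝓘(ℂ).prod 𝓘(ℂ))) (𝓘(ℂ).prod (𝓘(ℂ).prod 𝓘(ℂ)))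
    (C × C × C) (C × C × C) ω where
  toEquiv := splitting₂
  contMDiff_toFun := (contMDiff_fst.comp contMDiff_snd).prodMk
    (contMDiff_fst.prodMk (contMDiff_snd.comp contMDiff_snd))
  contMDiff_invFun := (contMDiff_fst.comp contMDiff_snd).prodMk
    (contMDiff_fst.prodMk (contMDiff_snd.comp contMDiff_snd))

/-- The rearrangement `(x, y, z) ↦ (z, (x, y))` as a biholomorphic map. -/
def splitDiffeo₃ : Diffeomorph (𝓘(ℂ).prod (𝓘(ℂ).prod 𝓘(ℂ))) (𝓘(ℂ).prod (𝓘(ℂ).prod 𝓘(ℂ)))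
    (C × C × C) (C × C × C) ω where
  toEquiv := splitting₃
  contMDiff_toFun := (contMDiff_snd.comp contMDiff_snd).prodMk
    (contMDiff_fst.prodMk (contMDiff_fst.comp contMDiff_snd))
  contMDiff_invFun := (contMDiff_fst.comp contMDiff_snd).prodMk
    ((contMDiff_snd.comp contMDiff_snd).prodMk contMDiff_fst)

variable [IsManifold 𝓘(ℂ) ω C] [CompactSpace C] [ConnectedSpace C]

/-- For a curve of genus at least two, `g` permutes the factors of `C × C × C`: its `i`-th
coordinate is a function of the coordinate with index `coordIndex hC g i`. -/
def coordIndex (hC : 2 ≤ genus C) (g : AutThree C C C) (i : Fin 3) : Fin 3 :=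
  (exists_coord_dependence hC ((contMDiff_coord i).comp g.contMDiff)).choose

variable (hC : 2 ≤ genus C)

theorem coordDependsOn_coordIndex (g : AutThree C C C) (i : Fin 3) :
    CoordDependsOn g i (coordIndex hC g i) :=
  (exists_coord_dependence hC ((contMDiff_coord i).comp g.contMDiff)).choose_spec

variable {hC} in
theorem CoordDependsOn.coordIndex_eq {g : AutThree C C C} {i j : Fin 3}
    (h : CoordDependsOn g i j) : coordIndex hC g i = j :=
  (coordDependsOn_coordIndex hC g i).unique h

/-- The order is reversed: the output of `g` is traced back first, then that of `h`. -/
theorem coordIndex_mul (g h : AutThree C C C) (i : Fin 3) :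
    coordIndex hC (g * h) i = coordIndex hC h (coordIndex hC g i) :=
  ((coordDependsOn_coordIndex hC g i).mul (coordDependsOn_coordIndex hC h _)).coordIndex_eq

theorem coordIndex_one (i : Fin 3) : coordIndex hC (1 : AutThree C C C) i = i :=
  CoordDependsOn.coordIndex_eq fun _ _ h => h

theorem coordIndex_inv_coordIndex (g : AutThree C C C) (i : Fin 3) :
    coordIndex hC g⁻¹ (coordIndex hC g i) = i := by
  rw [← coordIndex_mul, mul_inv_cancel, coordIndex_one]

theorem coordIndex_injective (g : AutThree C C C) : Function.Injective (coordIndex hC g) :=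
  Function.LeftInverse.injective (coordIndex_inv_coordIndex hC g)

theorem coordIndex_inv_eq {g : AutThree C C C} {i j : Fin 3} (h : coordIndex hC g i = j) :
    coordIndex hC g⁻¹ j = i := h ▸ coordIndex_inv_coordIndex hC g i

/-- If the `i`-th factor is preserved, the remaining two coordinates depend only on the remaining
two coordinates. -/
theorem coord_eq_of_coordIndex_eq {g : AutThree C C C} {i : Fin 3} (h : coordIndex hC g i = i)
    (p q : C × C × C) (hpq : ∀ j, j ≠ i → coord j p = coord j q) (j : Fin 3) (hj : j ≠ i) :
    coord j (g p) = coord j (g q) :=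
  coordDependsOn_coordIndex hC g j p q <| hpq _ fun h' =>
    hj (coordIndex_injective hC g (h'.trans h.symm))

/-- Injectivity of `coordIndex` keeps the other two coordinates among themselves, and the inverse
has the same property, so the map splits. Membership becomes a condition on a permutation. -/
theorem mem_factor₁_iff {G : Subgroup (AutThree C C C)} {g : AutThree C C C} :
    g ∈ factor₁ G ↔ g ∈ G ∧ coordIndex hC g 0 = 0 := by
  refine ⟨fun h => ⟨h.1, (factor₁_coordDependsOn h).coordIndex_eq⟩, fun ⟨hg, h⟩ => ⟨hg, ?_⟩⟩
  have h0 : ∀ g : AutThree C C C, coordIndex hC g 0 = 0 → ∀ p q : C × C × C, p.1 = q.1 →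
      (g p).1 = (g q).1 := fun g h p q hpq =>
    coordDependsOn_coordIndex hC g 0 p q (by rw [h]; exact hpq)
  have h2 : ∀ g : AutThree C C C, coordIndex hC g 0 = 0 → ∀ p q : C × C × C, p.2 = q.2 →
      (g p).2 = (g q).2 := fun g h p q hpq => by
    have := coord_eq_of_coordIndex_eq hC h p q (fun j hj => by
      fin_cases j
      exacts [absurd rfl hj, congrArg Prod.fst hpq, congrArg Prod.snd hpq])
    exact Prod.ext (this 1 (by decide)) (this 2 (by decide))
  exact mem_splitSubgroup_of_dependence (Diffeomorph.refl _ _ ω) g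
    (h0 g h) (h0 _ (coordIndex_inv_eq hC h)) (h2 g h) (h2 _ (coordIndex_inv_eq hC h))

theorem mem_factor₂_iff {G : Subgroup (AutThree C C C)} {g : AutThree C C C} :
    g ∈ factor₂ G ↔ g ∈ G ∧ coordIndex hC g 1 = 1 := by
  refine ⟨fun h => ⟨h.1, (factor₂_coordDependsOn h).coordIndex_eq⟩, fun ⟨hg, h⟩ => ⟨hg, ?_⟩⟩
  have h0 : ∀ g : AutThree C C C, coordIndex hC g 1 = 1 → ∀ p q : C × C × C, p.2.1 = q.2.1 →
      (g p).2.1 = (g q).2.1 := fun g h p q hpq =>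
    coordDependsOn_coordIndex hC g 1 p q (by rw [h]; exact hpq)
  have h2 : ∀ g : AutThree C C C, coordIndex hC g 1 = 1 → ∀ p q : C × C × C,
      (splitting₂ p).2 = (splitting₂ q).2 → (splitting₂ (g p)).2 = (splitting₂ (g q)).2 :=
    fun g h p q hpq => by
    obtain ⟨hpq₁, hpq₂⟩ := Prod.ext_iff.1 hpq
    have := coord_eq_of_coordIndex_eq hC h p q (fun j hj => by
      fin_cases j
      exacts [hpq₁, absurd rfl hj, hpq₂])
    exact Prod.ext (this 0 (by decide)) (this 2 (by decide))
  exact mem_splitSubgroup_of_dependence splitDiffeo₂ g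
    (h0 g h) (h0 _ (coordIndex_inv_eq hC h)) (h2 g h) (h2 _ (coordIndex_inv_eq hC h))

theorem mem_factor₃_iff {G : Subgroup (AutThree C C C)} {g : AutThree C C C} :
    g ∈ factor₃ G ↔ g ∈ G ∧ coordIndex hC g 2 = 2 := by
  refine ⟨fun h => ⟨h.1, (factor₃_coordDependsOn h).coordIndex_eq⟩, fun ⟨hg, h⟩ => ⟨hg, ?_⟩⟩
  have h0 : ∀ g : AutThree C C C, coordIndex hC g 2 = 2 → ∀ p q : C × C × C, p.2.2 = q.2.2 →
      (g p).2.2 = (g q).2.2 := fun g h p q hpq =>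
    coordDependsOn_coordIndex hC g 2 p q (by rw [h]; exact hpq)
  have h2 : ∀ g : AutThree C C C, coordIndex hC g 2 = 2 → ∀ p q : C × C × C,
      (splitting₃ p).2 = (splitting₃ q).2 → (splitting₃ (g p)).2 = (splitting₃ (g q)).2 :=
    fun g h p q hpq => by
    obtain ⟨hpq₁, hpq₂⟩ := Prod.ext_iff.1 hpq
    have := coord_eq_of_coordIndex_eq hC h p q (fun j hj => by
      fin_cases j
      exacts [hpq₁, hpq₂, absurd rfl hj])
    exact Prod.ext (this 0 (by decide)) (this 1 (by decide))
  exact mem_splitSubgroup_of_dependence splitDiffeo₃ g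
    (h0 g h) (h0 _ (coordIndex_inv_eq hC h)) (h2 g h) (h2 _ (coordIndex_inv_eq hC h))

theorem mem_diagonal_iff_coordIndex {G : Subgroup (AutThree C C C)} {g : AutThree C C C} :
    g ∈ diagonal G ↔ g ∈ G ∧ ∀ i, coordIndex hC g i = i := by
  refine ⟨fun h => ⟨h.1, fun i => ?_⟩, fun ⟨hg, h⟩ => ⟨hg, ?_⟩⟩
  · fin_cases i
    exacts [((mem_factor₁_iff hC).1 (diagonal_le_factor₁ G h)).2,
      ((mem_factor₂_iff hC).1 (diagonal_le_factor₂ G h)).2,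
      ((mem_factor₃_iff hC).1 (diagonal_le_factor₃ G h)).2]
  -- Each of the three splittings supplies one component; its complementary part is discarded.
  · obtain ⟨-, a, _, ha⟩ := (mem_factor₁_iff hC).2 ⟨hg, h 0⟩
    obtain ⟨-, b, _, hb⟩ := (mem_factor₂_iff hC).2 ⟨hg, h 1⟩
    obtain ⟨-, c, _, hc⟩ := (mem_factor₃_iff hC).2 ⟨hg, h 2⟩
    refine ⟨a, b, c, Diffeomorph.ext fun p => ?_⟩
    have h₁ := congrArg Prod.fst (ha p)
    have h₂ := congrArg Prod.fst (hb p)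
    have h₃ := congrArg Prod.fst (hc p)
    exact Prod.ext h₁ (Prod.ext h₂ h₃)

theorem coordIndex_of_cyclic {τ : AutThree C C C} {t : AutCurve C}
    (hτ : ∀ x y z, τ (x, y, z) = (y, z, t x)) (i : Fin 3) : coordIndex hC τ i = i + 1 := by
  refine CoordDependsOn.coordIndex_eq ?_
  rintro ⟨x, y, z⟩ ⟨x', y', z'⟩ h
  rw [hτ, hτ]
  fin_cases i
  exacts [h, h, congrArg t h]

theorem coordIndex_inv_of_cyclic {τ : AutThree C C C} {t : AutCurve C}
    (hτ : ∀ x y z, τ (x, y, z) = (y, z, t x)) (i : Fin 3) : coordIndex hC τ⁻¹ i = i + 2 := by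
  refine coordIndex_inv_eq hC ?_
  rw [coordIndex_of_cyclic hC hτ]
  fin_cases i <;> rfl

end Cube

/-! ### Formulas for a cyclic `τ`, and index three -/

section Cyclic

variable {C : Type*} [TopologicalSpace C] [ChartedSpace ℂ C]

/-- `τ` moves the second coordinate into the first slot, where `ψ₁` reads it; `τ²` does the same for
the third. -/
theorem ψ₂_eq_of_cyclic [Nonempty C] {G : Subgroup (AutThree C C C)} {τ : AutThree C C C} {t : AutCurve C}
    (hτ : ∀ x y z, τ (x, y, z) = (y, z, t x)) {h : AutThree C C C} (h₂ : h ∈ factor₂ G)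
    (h₁ : τ * h * τ⁻¹ ∈ factor₁ G) : ψ₂ G ⟨h, h₂⟩ = ψ₁ G ⟨τ * h * τ⁻¹, h₁⟩ := by
  refine Diffeomorph.ext fun y => ?_
  have hτ' : ∀ q, (τ q).1 = q.2.1 := fun q => congrArg Prod.fst (hτ q.1 q.2.1 q.2.2)
  have e₂ := ψ₂_apply G ⟨h, h₂⟩ (y, y, y)
  have e₁ := ψ₁_mul_inv_apply h₁ (y, y, y)
  rw [hτ', hτ'] at e₁
  exact e₂.trans e₁.symm

theorem fst_sq_apply_of_cyclic {τ : AutThree C C C} {t : AutCurve C}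
    (hτ : ∀ x y z, τ (x, y, z) = (y, z, t x)) (q : C × C × C) : ((τ ^ 2) q).1 = q.2.2 := by
  obtain ⟨x, y, z⟩ := q
  rw [pow_two, mul_apply, hτ, hτ]

theorem ψ₃_eq_of_cyclic [Nonempty C] {G : Subgroup (AutThree C C C)} {τ : AutThree C C C} {t : AutCurve C}
    (hτ : ∀ x y z, τ (x, y, z) = (y, z, t x)) {k : AutThree C C C} (h₃ : k ∈ factor₃ G)
    (h₁ : τ ^ 2 * k * (τ ^ 2)⁻¹ ∈ factor₁ G) :
    ψ₃ G ⟨k, h₃⟩ = ψ₁ G ⟨τ ^ 2 * k * (τ ^ 2)⁻¹, h₁⟩ := by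
  refine Diffeomorph.ext fun z => ?_
  have e₃ := ψ₃_apply G ⟨k, h₃⟩ (z, z, z)
  have e₁ := ψ₁_mul_inv_apply h₁ (z, z, z)
  rw [fst_sq_apply_of_cyclic hτ, fst_sq_apply_of_cyclic hτ] at e₁
  exact e₃.trans e₁.symm

theorem cyclic_form [Nonempty C] {G : Subgroup (AutThree C C C)} {τ : AutThree C C C} {t : AutCurve C}
    (hτG : τ ∈ G) (hτ : ∀ x y z, τ (x, y, z) = (y, z, t x)) : ∃ h₁ : τ ^ 3 ∈ factor₁ G,
      ∀ x y z, τ (x, y, z) = (y, z, ψ₁ G ⟨τ ^ 3, h₁⟩ x) := by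
  have h₁ : τ ^ 3 ∈ factor₁ G := by
    refine diagonal_le_factor₁ G ⟨G.pow_mem hτG 3, t, t, t, Diffeomorph.ext fun ⟨x, y, z⟩ => ?_⟩
    simp only [pow_succ, pow_zero, one_mul, mul_apply, hτ, prodThree_apply]
  refine ⟨h₁, fun x y z => ?_⟩
  have e₁ := ψ₁_apply G ⟨τ ^ 3, h₁⟩ (x, y, z)
  have e₂ : ((τ ^ 3) (x, y, z)).1 = t x := by
    simp only [pow_succ, pow_zero, one_mul, mul_apply, hτ]
  rw [hτ, ← e₂]
  exact congrArg (fun u => (y, z, u)) e₁.symm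

theorem conj_cyclic_mem_diagonal {G : Subgroup (AutThree C C C)} {τ : AutThree C C C}
    {t : AutCurve C} (hτG : τ ∈ G) (hτ : ∀ x y z, τ (x, y, z) = (y, z, t x))
    {g : AutThree C C C} (hg : g ∈ diagonal G) : τ * g * τ⁻¹ ∈ diagonal G := by
  obtain ⟨hg, a, b, c, rfl⟩ := hg
  refine ⟨G.mul_mem (G.mul_mem hτG hg) (G.inv_mem hτG), b, c, t * a * t⁻¹, ?_⟩
  rw [mul_inv_eq_iff_eq_mul]
  refine Diffeomorph.ext fun ⟨x, y, z⟩ => ?_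
  simp only [mul_apply, prodThree_apply, hτ, inv_apply_self]

theorem conj_sq_cyclic_mem_diagonal {G : Subgroup (AutThree C C C)} {τ : AutThree C C C}
    {t : AutCurve C} (hτG : τ ∈ G) (hτ : ∀ x y z, τ (x, y, z) = (y, z, t x))
    {g : AutThree C C C} (hg : g ∈ diagonal G) : τ ^ 2 * g * (τ ^ 2)⁻¹ ∈ diagonal G := by
  have := conj_cyclic_mem_diagonal hτG hτ (conj_cyclic_mem_diagonal hτG hτ hg)
  rwa [show τ ^ 2 * g * (τ ^ 2)⁻¹ = τ * (τ * g * τ⁻¹) * τ⁻¹ by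
    simp only [pow_two, mul_inv_rev, mul_assoc]]

theorem diagonal_form_of_cyclic [Nonempty C] {G : Subgroup (AutThree C C C)} {τ : AutThree C C C}
    {t : AutCurve C} (hτG : τ ∈ G) (hτ : ∀ x y z, τ (x, y, z) = (y, z, t x))
    {g : AutThree C C C} (hg : g ∈ diagonal G) :
    ∃ (h₁ : g ∈ factor₁ G) (h₂ : τ * g * τ⁻¹ ∈ factor₁ G)
      (h₃ : τ ^ 2 * g * (τ ^ 2)⁻¹ ∈ factor₁ G), ∀ x y z,
      g (x, y, z) = (ψ₁ G ⟨g, h₁⟩ x, ψ₁ G ⟨τ * g * τ⁻¹, h₂⟩ y,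
        ψ₁ G ⟨τ ^ 2 * g * (τ ^ 2)⁻¹, h₃⟩ z) := by
  have h₁ := diagonal_le_factor₁ G hg
  have h₂ := diagonal_le_factor₁ G (conj_cyclic_mem_diagonal hτG hτ hg)
  have h₃ := diagonal_le_factor₁ G (conj_sq_cyclic_mem_diagonal hτG hτ hg)
  refine ⟨h₁, h₂, h₃, fun x y z => ?_⟩
  rw [← ψ₂_eq_of_cyclic hτ (diagonal_le_factor₂ G hg), ← ψ₃_eq_of_cyclic hτ
    (diagonal_le_factor₃ G hg)]
  exact Prod.ext (ψ₁_apply G ⟨g, h₁⟩ (x, y, z)).symm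
    (Prod.ext (ψ₂_apply G ⟨g, _⟩ (x, y, z)).symm (ψ₃_apply G ⟨g, _⟩ (x, y, z)).symm)

theorem isNormalFormThree [Nonempty C] {G : Subgroup (AutThree C C C)} (hG : (diagonal G).relIndex G = 3)
    {τ : AutThree C C C} {t : AutCurve C} (hτG : τ ∈ G)
    (hτ : ∀ x y z, τ (x, y, z) = (y, z, t x)) : IsNormalFormThree G τ := by
  refine ⟨fun g hg => ⟨diagonal_le_factor₂ G hg,
      diagonal_le_factor₁ G (conj_cyclic_mem_diagonal hτG hτ hg), ψ₂_eq_of_cyclic hτ _ _⟩,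
    fun g hg => ⟨diagonal_le_factor₃ G hg,
      diagonal_le_factor₁ G (conj_sq_cyclic_mem_diagonal hτG hτ hg), ψ₃_eq_of_cyclic hτ _ _⟩,
    cyclic_form hτG hτ, fun g hg => diagonal_form_of_cyclic hτG hτ hg, fun h hh => ?_⟩
  obtain ⟨u, v, huv⟩ := (nontrivial_of_chartedSpace C).exists_pair_ne
  have hτ_notMem : τ ∉ diagonal G := by
    rintro ⟨-, a, b, c, rfl⟩
    have h1 := congrArg Prod.fst (hτ u u u)
    have h2 := congrArg Prod.fst (hτ u v u)
    exact huv (h1.symm.trans h2)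
  have hτ2_notMem : τ ^ 2 ∉ diagonal G := by
    rintro ⟨-, a, b, c, h⟩
    have h1 := fst_sq_apply_of_cyclic hτ (u, u, u)
    have h2 := fst_sq_apply_of_cyclic hτ (u, u, v)
    rw [h] at h1 h2
    exact huv (h1.symm.trans h2)
  let H := (diagonal G).subgroupOf G
  let s : G := ⟨τ, hτG⟩
  have hs1 : s ∉ H := hτ_notMem
  have hs2 : s ^ 2 ∉ H := hτ2_notMem
  -- The cosets of `1`, `τ`, `τ²` are distinct because `τ` and `τ²` are not diagonal; as the index
  -- is three, they are all the cosets.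
  let q : Fin 3 → G ⧸ H := ![((1 : G) : G ⧸ H), (s : G ⧸ H), ((s ^ 2 : G) : G ⧸ H)]
  have h01 : q 0 ≠ q 1 := fun h => hs1 (by simpa using QuotientGroup.eq.1 h)
  have h02 : q 0 ≠ q 2 := fun h => hs2 (by simpa using QuotientGroup.eq.1 h)
  have h12 : q 1 ≠ q 2 := fun h => hs1 (by simpa [pow_two] using QuotientGroup.eq.1 h)
  have hinj : Function.Injective q := by
    intro i j hij
    fin_cases i <;> fin_cases j
    exacts [rfl, absurd hij h01, absurd hij h02, absurd hij h01.symm, rfl, absurd hij h12,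
      absurd hij h02.symm, absurd hij h12.symm, rfl]
  have hcard : Nat.card (G ⧸ H) = 3 := hG
  have : Finite (G ⧸ H) := Nat.finite_of_card_ne_zero (by rw [hcard]; decide)
  obtain ⟨i, hi⟩ := (hinj.bijective_of_nat_card_le (by simp [hcard])).2 ((⟨h, hh⟩ : G) : G ⧸ H)
  fin_cases i
  · refine ⟨h, ?_, Or.inl rfl⟩
    have : (1 : G)⁻¹ * ⟨h, hh⟩ ∈ H := QuotientGroup.eq.1 hi
    rw [inv_one, one_mul] at this
    exact this
  · have hm : s⁻¹ * ⟨h, hh⟩ ∈ H := QuotientGroup.eq.1 hi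
    exact ⟨τ⁻¹ * h, hm, Or.inr (Or.inl (mul_inv_cancel_left τ h).symm)⟩
  · have hm : (s ^ 2)⁻¹ * ⟨h, hh⟩ ∈ H := QuotientGroup.eq.1 hi
    exact ⟨(τ ^ 2)⁻¹ * h, hm,
      Or.inr (Or.inr (mul_inv_cancel_left (τ ^ 2) h).symm)⟩

end Cyclic

/-! ### Index six -/

section IndexSix

variable {C : Type*} [TopologicalSpace C] [ChartedSpace ℂ C] [IsManifold 𝓘(ℂ) ω C]
  [CompactSpace C] [ConnectedSpace C]

theorem isNormalFormSix (hC : 2 ≤ genus C) {G : Subgroup (AutThree C C C)}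
    {τ : AutThree C C C} {t : AutCurve C} (hτG : τ ∈ G)
    (hτ : ∀ x y z, τ (x, y, z) = (y, z, t x)) : IsNormalFormSix G τ := by
  have hτi := coordIndex_of_cyclic hC hτ
  have hτi' := coordIndex_inv_of_cyclic hC hτ
  have hτ2G := G.pow_mem hτG 2
  -- On indices `τ` shifts by `1` and `τ⁻¹` by `2`, modulo three; these are the sums that arise.
  have h1 : ((1 : Fin 3) + 2) = 0 := rfl
  have h2 : ((2 : Fin 3) + 2 + 2) = 0 := rfl
  have h3 : ((0 : Fin 3) + 1 + 1) = 2 := rfl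
  have h4 : ((0 : Fin 3) + 2 + 2) = 1 := rfl
  refine ⟨fun h h₂ => ?_, fun k h₃ => ?_, cyclic_form hτG hτ,
    fun g hg => diagonal_form_of_cyclic hτG hτ hg, fun f h₁ hf => ?_, fun h hh => ?_⟩
  · obtain ⟨hG, hi⟩ := (mem_factor₂_iff hC).1 h₂
    refine ⟨(mem_factor₁_iff hC).2 ⟨G.mul_mem (G.mul_mem hτG hG) (G.inv_mem hτG), ?_⟩,
      ψ₂_eq_of_cyclic hτ _ _⟩
    rw [coordIndex_mul, coordIndex_mul, hτi, zero_add, hi, hτi', h1]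
  · obtain ⟨hG, hi⟩ := (mem_factor₃_iff hC).1 h₃
    refine ⟨(mem_factor₁_iff hC).2 ⟨G.mul_mem (G.mul_mem hτ2G hG) (G.inv_mem hτ2G), ?_⟩,
      ψ₃_eq_of_cyclic hτ _ _⟩
    rw [pow_two, mul_inv_rev]
    simp only [coordIndex_mul, hτi, hτi', h3, hi, h2]
  · obtain ⟨hG, h0⟩ := (mem_factor₁_iff hC).1 h₁
    have hinj := coordIndex_injective hC f
    have hne : ¬ ∀ i, coordIndex hC f i = i := fun h =>
      hf ((mem_diagonal_iff_coordIndex hC).2 ⟨hG, h⟩)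
    -- Since `f` fixes the first factor and is not diagonal, it must exchange the other two.
    have hswap : ∀ σ : Fin 3 → Fin 3, Function.Injective σ → σ 0 = 0 → (¬ ∀ i, σ i = i) →
        σ 1 = 2 ∧ σ 2 = 1 := by decide
    obtain ⟨hf1, hf2⟩ := hswap _ hinj h0 hne
    have m₂ : τ * f * (τ ^ 2)⁻¹ ∈ factor₁ G := by
      refine (mem_factor₁_iff hC).2 ⟨G.mul_mem (G.mul_mem hτG hG) (G.inv_mem hτ2G), ?_⟩
      rw [pow_two, mul_inv_rev]
      simp only [coordIndex_mul, hτi, hτi', zero_add, hf1, h2]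
    have m₃ : τ ^ 2 * f * τ⁻¹ ∈ factor₁ G := by
      refine (mem_factor₁_iff hC).2 ⟨G.mul_mem (G.mul_mem hτ2G hG) (G.inv_mem hτG), ?_⟩
      rw [pow_two]
      simp only [coordIndex_mul, hτi, hτi', h3, hf2, h1]
    refine ⟨m₂, m₃, fun x y z => ?_⟩
    have e₁ := ψ₁_apply G ⟨f, h₁⟩ (x, y, z)
    have e₂ := ψ₁_mul_inv_apply m₂ (x, y, z)
    have e₃ := ψ₁_mul_inv_apply m₃ (x, y, z)
    have hτ' : ∀ q, (τ q).1 = q.2.1 := fun q => congrArg Prod.fst (hτ q.1 q.2.1 q.2.2)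
    rw [fst_sq_apply_of_cyclic hτ, hτ'] at e₂
    rw [fst_sq_apply_of_cyclic hτ, hτ'] at e₃
    exact Prod.ext e₁.symm (Prod.ext e₂.symm e₃.symm)
  -- `k` is the output slot of `h` governed by the first input. A power of `τ⁻¹` brings it to slot
  -- `0`: two steps for `k = 1`, one for `k = 2`.
  · obtain ⟨k, hk⟩ := (Finite.injective_iff_surjective.1 (coordIndex_injective hC h)) 0
    fin_cases k
    · exact ⟨h, (mem_factor₁_iff hC).2 ⟨hh, hk⟩, Or.inl rfl⟩
    · refine ⟨(τ ^ 2)⁻¹ * h, (mem_factor₁_iff hC).2 ⟨G.mul_mem (G.inv_mem hτ2G) hh, ?_⟩,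
        Or.inr (Or.inr (mul_inv_cancel_left _ h).symm)⟩
      rw [pow_two, mul_inv_rev]
      simp only [coordIndex_mul, hτi', h4]
      exact hk
    · refine ⟨τ⁻¹ * h, (mem_factor₁_iff hC).2 ⟨G.mul_mem (G.inv_mem hτG) hh, ?_⟩,
        Or.inr (Or.inl (mul_inv_cancel_left _ h).symm)⟩
      simp only [coordIndex_mul, hτi', zero_add]
      exact hk

end IndexSix

/-- Identifying all factors with `X` along `τ` leaves two plain shifts and collects the whole twist
`τ₂ τ₃ τ₁` in the last slot. -/
theorem conj_epsMap_apply {X Y Z : Type*} [TopologicalSpace X] [ChartedSpace ℂ X]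
    [TopologicalSpace Y] [ChartedSpace ℂ Y] [TopologicalSpace Z] [ChartedSpace ℂ Z]
    (τ₁ : CurveIso X Z) (τ₂ : CurveIso Y X) (τ₃ : CurveIso Z Y) {τ : AutThree X Y Z}
    (hτ : ∀ x y z, τ (x, y, z) = (τ₂ y, τ₃ z, τ₁ x)) (x y z : X) :
    conj (epsMap τ₂ τ₃) τ (x, y, z) = (y, z, (τ₁.trans (τ₃.trans τ₂)) x) := by
  rw [conj_apply]
  change epsMap τ₂ τ₃ (τ (x, τ₂.symm y, τ₃.symm (τ₂.symm z))) = _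
  rw [hτ, epsMap_apply, τ₂.apply_symm_apply, τ₃.apply_symm_apply, τ₂.apply_symm_apply]
  rfl

end MixedAction

end

theorem proposition2p1 {C₁ C₂ C₃ : Type*}
    [TopologicalSpace C₁] [ChartedSpace ℂ C₁] [IsManifold 𝓘(ℂ) ω C₁]
    [T2Space C₁] [CompactSpace C₁] [ConnectedSpace C₁]
    [TopologicalSpace C₂] [ChartedSpace ℂ C₂] [IsManifold 𝓘(ℂ) ω C₂]
    [T2Space C₂] [CompactSpace C₂] [ConnectedSpace C₂]
    [TopologicalSpace C₃] [ChartedSpace ℂ C₃] [IsManifold 𝓘(ℂ) ω C₃]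
    [T2Space C₃] [CompactSpace C₃] [ConnectedSpace C₃]
    (hC₁ : 2 ≤ genus C₁) (hC₂ : 2 ≤ genus C₂) (hC₃ : 2 ≤ genus C₃)
    (G : Subgroup (AutThree C₁ C₂ C₃)) :
    -- index two: `δ(x, y, z) = (δ₁ x, δ₃ z, δ₂ y)` and `ξ(x, y, z) = (x, y, δ₃ z)`
    ((diagonal G).relIndex G = 2 →
      ∀ (δ₁ : AutCurve C₁) (δ₂ : CurveIso C₂ C₃) (δ₃ : CurveIso C₃ C₂), ∀ δ ∈ G,
        (∀ x y z, δ (x, y, z) = (δ₁ x, δ₃ z, δ₂ y)) →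
        IsNormalFormTwo (G.map (conj (xiMap δ₃))) (conj (xiMap δ₃) δ)) ∧
    -- index three: `τ(x, y, z) = (τ₂ y, τ₃ z, τ₁ x)` and `ε(x, y, z) = (x, τ₂ y, τ₂ τ₃ z)`
    ((diagonal G).relIndex G = 3 →
      ∀ (τ₁ : CurveIso C₁ C₃) (τ₂ : CurveIso C₂ C₁) (τ₃ : CurveIso C₃ C₂), ∀ τ ∈ G,
        (∀ x y z, τ (x, y, z) = (τ₂ y, τ₃ z, τ₁ x)) →
        IsNormalFormThree (G.map (conj (epsMap τ₂ τ₃))) (conj (epsMap τ₂ τ₃) τ)) ∧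
    -- index six: the same `τ` and `ε`
    ((diagonal G).relIndex G = 6 →
      ∀ (τ₁ : CurveIso C₁ C₃) (τ₂ : CurveIso C₂ C₁) (τ₃ : CurveIso C₃ C₂), ∀ τ ∈ G,
        (∀ x y z, τ (x, y, z) = (τ₂ y, τ₃ z, τ₁ x)) →
        IsNormalFormSix (G.map (conj (epsMap τ₂ τ₃))) (conj (epsMap τ₂ τ₃) τ)) := by
  refine ⟨fun hG δ₁ δ₂ δ₃ δ hδG hδ => ?_, fun hG τ₁ τ₂ τ₃ τ hτG hτ => ?_,
    fun _ τ₁ τ₂ τ₃ τ hτG hτ => ?_⟩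
  -- After conjugation the twist on the last slot is the composite `δ₃ ∘ δ₂`.
  · refine isNormalFormTwo ((relIndex_diagonal_map_conj _ _ _ G).trans hG)
      (Subgroup.mem_map_of_mem _ hδG) δ₁ (δ₂.trans δ₃) fun x y z => ?_
    rw [conj_apply]
    change xiMap δ₃ (δ (x, y, δ₃.symm z)) = _
    rw [hδ, xiMap_apply, δ₃.apply_symm_apply]
    rfl
  · refine isNormalFormThree ((relIndex_diagonal_map_conj _ _ _ G).trans hG)
      (Subgroup.mem_map_of_mem _ hτG) (conj_epsMap_apply τ₁ τ₂ τ₃ hτ)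
  · exact isNormalFormSix hC₁ (Subgroup.mem_map_of_mem _ hτG) (conj_epsMap_apply τ₁ τ₂ τ₃ hτ)
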